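/- Let $n\ge 2$ and, for $\mathbb K\in\{\mathbb R,\mathbb C\}$, let $X_{\mathbb K}\subset\mathbb P(\mathbb K^2\otimes\mathbb K^n\otimes\mathbb K^n)$ be the Segre variety of points $[a\otimes b\otimes c]$. The rank $\mathrm{rk}_{X_{\mathbb K}}(f)$ of a point $f$ is the least $s$ such that $f$ lies in the linear span of $s$ distinct points of $X_{\mathbb K}$. An integer $s$ is a typical rank of $X_{\mathbb R}$ if the set of real points of rank $s$ contains a nonempty Euclidean open set, and the generic rank of $X_{\mathbb C}$ is the integer that equals the rank of all points of some nonempty Zariski open set. Let $g$ be the generic rank of $X_{\mathbb C}$ and let $\mathcal R=\{f\in\mathbb P(\mathbb R^2\otimes\mathbb R^n\otimes\mathbb R^n) : \mathrm{rk}_{X_{\mathbb R}}(f)=g\}$. The real rank boundary of $X_{\mathbb R}$ is the Zariski closure, in $\mathbb P(\mathbb C^2\otimes\mathbb C^n\otimes\mathbb C^n)$, of the topological boundary (closure minus interior) of $\mathcal R$. Then: 1. $g=n$, and the typical ranks of $X_{\mathbb R}$ are exactly $n$ and $n+1$; 2. the real rank boundary of $X_{\mathbb R}$ (which divides the typical ranks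 $n$ and $n+1$) is the hyperdeterminant of $2\times n\times n$ tensors, that is, it equals the dual variety $X_{\mathbb C}^\vee$, the Zariski closure of the set of hyperplanes tangent to $X_{\mathbb C}$, where the hyperplane $\sum_{i,j,k}T_{ijk}v_{ijk}=0$ is identified with the point $[T]$; 3. this set is an irreducible hypersurface, the zero locus of an irreducible homogeneous polynomial over $\mathbb C$ (the hyperdeterminant polynomial). -/

import Mathlib

open scoped LinearAlgebra.Projectivization

/-! ## Points of projective space: topology, complexification, Zariski closure -/

/-- The Euclidean topology on real projective space: the quotient topology from the nonzero
vectors. -/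
instance realProjectiveTopology {ι : Type*} : TopologicalSpace (ℙ ℝ (ι → ℝ)) :=
  inferInstanceAs (TopologicalSpace (Quotient (projectivizationSetoid ℝ (ι → ℝ))))

/-- The coordinatewise inclusion of real vectors into complex vectors. -/
noncomputable def complexifyVec (ι : Type*) : (ι → ℝ) →ₛₗ[Complex.ofRealHom] (ι → ℂ) where
  toFun v i := (v i : ℂ)
  map_add' v w := by ext i; simp
  map_smul' a v := by ext i; simp

theorem complexifyVec_injective (ι : Type*) : Function.Injective (complexifyVec ι) := by
  intro v w h
  ext i
  exact Complex.ofReal_injective (congrFun h i)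

/-- The inclusion of real projective space into complex projective space. -/
noncomputable def complexifyPoint {ι : Type*} : ℙ ℝ (ι → ℝ) → ℙ ℂ (ι → ℂ) :=
  Projectivization.map (complexifyVec ι) (complexifyVec_injective ι)

/-- The zero locus in complex projective space of a (homogeneous) polynomial. -/
def projZeros {ι : Type*} (F : MvPolynomial ι ℂ) : Set (ℙ ℂ (ι → ℂ)) :=
  {p | MvPolynomial.eval p.rep F = 0}

/-- The Zariski closure of a set of points of complex projective space. -/
def zariskiClosure {ι : Type*} (S : Set (ℙ ℂ (ι → ℂ))) : Set (ℙ ℂ (ι → ℂ)) :=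
  {p | ∀ (F : MvPolynomial ι ℂ) (d : ℕ), F.IsHomogeneous d → S ⊆ projZeros F → p ∈ projZeros F}

/-! ## Rank with respect to a set of points, typical and generic ranks, real rank boundary -/

/-- The `X`-rank of a point: the least number of distinct points of `X` whose linear span
contains it (`⊤` if there is no such finite set). -/
noncomputable def xRank {K V : Type*} [Field K] [AddCommGroup V] [Module K V]
    (X : Set (ℙ K V)) (f : ℙ K V) : ℕ∞ :=
  ⨅ (S : Finset (ℙ K V)) (_ : (S : Set (ℙ K V)) ⊆ X ∧ f.submodule ≤ ⨆ p ∈ S, p.submodule),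
    (S.card : ℕ∞)

/-- `s` is a typical rank of the real variety `X`: the points of rank `s` contain a nonempty
Euclidean open set. -/
def IsTypicalRank {ι : Type*} (X : Set (ℙ ℝ (ι → ℝ))) (s : ℕ) : Prop :=
  (interior {f | xRank X f = s}).Nonempty

/-- `g` is the generic rank of the complex variety `X`: all points of some nonempty Zariski open
set have rank `g`. -/
def IsGenericRank {ι : Type*} (X : Set (ℙ ℂ (ι → ℂ))) (g : ℕ) : Prop :=
  ∃ (F : MvPolynomial ι ℂ) (d : ℕ), F.IsHomogeneous d ∧ F ≠ 0 ∧
    ∀ f : ℙ ℂ (ι → ℂ), f ∉ projZeros F → xRank X f = g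

/-- The real points whose rank with respect to `X` is the generic rank of the
complexification `XC` of `X`. -/
def genericRankLocus {ι : Type*} (X : Set (ℙ ℝ (ι → ℝ))) (XC : Set (ℙ ℂ (ι → ℂ))) :
    Set (ℙ ℝ (ι → ℝ)) :=
  {f | ∃ g : ℕ, IsGenericRank XC g ∧ xRank X f = g}

/-- The real rank boundary of a real variety `X` with complexification `XC`: the complex Zariski
closure of the topological boundary (closure minus interior) of the locus of real points whose
real rank is the complex generic rank. -/
def realRankBoundary {ι : Type*} (X : Set (ℙ ℝ (ι → ℝ))) (XC : Set (ℙ ℂ (ι → ℂ))) :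
    Set (ℙ ℂ (ι → ℂ)) :=
  let R := genericRankLocus X XC
  zariskiClosure (complexifyPoint '' (closure R \ interior R))

/-! ## `2 × n × n` tensors, the Segre variety, the hyperdeterminant -/

/-- The coordinates of a `2 × n × n` tensor. -/
abbrev TensorIdx (n : ℕ) : Type := Fin 2 × Fin n × Fin n

/-- The decomposable tensor `a ⊗ b ⊗ c`. -/
def pureTensor {K : Type*} [Field K] {n : ℕ} (a : Fin 2 → K) (b c : Fin n → K) :
    TensorIdx n → K :=
  fun x => a x.1 * b x.2.1 * c x.2.2

/-- The `K`-points of the Segre variety `ℙ¹ × ℙⁿ⁻¹ × ℙⁿ⁻¹` in the space of `2 × n × n` tensors. -/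
def segre (K : Type*) [Field K] (n : ℕ) : Set (ℙ K (TensorIdx n → K)) :=
  {p | ∃ (a : Fin 2 → K) (b c : Fin n → K) (h : pureTensor a b c ≠ 0),
    p = Projectivization.mk K (pureTensor a b c) h}

/-- The embedded tangent space (as a linear space of tensors) to the Segre variety at
`a ⊗ b ⊗ c`, that is, the image of the differential of `(a, b, c) ↦ a ⊗ b ⊗ c`. -/
def segreTangentSpace {n : ℕ} (a : Fin 2 → ℂ) (b c : Fin n → ℂ) : Set (TensorIdx n → ℂ) :=
  {v | ∃ (a' : Fin 2 → ℂ) (b' c' : Fin n → ℂ),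
    v = pureTensor a' b c + pureTensor a b' c + pureTensor a b c'}

/-- The dual variety of the complex Segre variety: the Zariski closure of the set of hyperplanes
tangent to it at some point. The hyperplane with equation `∑ x, T x * v x = 0` in `v` is identified
with the point `T`. -/
def segreDual (n : ℕ) : Set (ℙ ℂ (TensorIdx n → ℂ)) :=
  zariskiClosure {T | ∃ (a : Fin 2 → ℂ) (b c : Fin n → ℂ), pureTensor a b c ≠ 0 ∧
    ∀ v ∈ segreTangentSpace a b c, ∑ x, T.rep x * v x = 0}

/-- `F` is the hyperdeterminant of `2 × n × n` tensors (unique up to a nonzero scalar): the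
irreducible homogeneous polynomial whose zero hypersurface is the dual variety of the Segre
variety. -/
def IsHyperdeterminant (n : ℕ) (F : MvPolynomial (TensorIdx n) ℂ) : Prop :=
  Irreducible F ∧ (∃ d : ℕ, F.IsHomogeneous d) ∧ projZeros F = segreDual n

/-! A `2 × n × n` tensor is a pencil of square matrices, and everything is read off from the binary
form `a ↦ det (slice T a)` of degree `n`. If some slice is invertible, at least `n` summands are
needed, and `n` suffice exactly when invertible left and right multiplications make the whole pencil
diagonal over the base field. For this it is enough that the form has `n` distinct roots
(`hasDecomp_of_roots`).

The form has a multiple root (or is zero) exactly when the hyperplane of `T` is tangent to the Segre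
variety: the double root and a pair of left and right kernel vectors at it give the point of
tangency (`coeff_pencilPoly_eq_zero_iff`). So the discriminant `hyperdet` cuts out the dual variety,
and off it complex tensors have rank `n`.

Over the reals, `n` sign changes of the form are an open condition that forces `n` real roots, hence
rank `n`. Negativity of the trace of `(adj(A) B)²`, for slices `A`, `B` with `A` invertible, is an
open condition that forbids rank `n`. Outside a proper algebraic subset, one rank-one correction of
`B` moves the roots to `0, …, n - 1`, so the rank is at most `n + 1`
(`hasDecomp_succ_of_adjMatrix`).

For the boundary, a form that splits into real linear factors satisfies a closed inequality
excluding nonreal roots. A limit of rank `n` tensors off the discriminant therefore has `n` distinct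
real roots and is interior (`mem_interior_of_mem_closure`). Conversely, tangent tensors are
parametrized by three matrices and a tensor tangent at a fixed base point. A nonempty open set of
real parameters lands on the boundary: the double root is not diagonalizable, but a small
perturbation splits it into two real roots (`IsNormal.mem_boundary`). A form vanishing on the
boundary thus pulls back to the zero polynomial and vanishes on the dual variety. The same pullback
lives in a domain, so one irreducible factor of `hyperdet` already vanishes on the dual variety,
which gives the irreducible equation. -/

namespace TensorPencil

open Matrix

/-! ## Slices of tensors -/

section Slices

variable {R : Type*} [CommRing R] {n : ℕ}

/-- The contraction of a `2 × n × n` tensor with a vector in its first argument. -/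
def slice (T : TensorIdx n → R) (a : Fin 2 → R) : Matrix (Fin n) (Fin n) R :=
  Matrix.of fun j k => a 0 * T (0, j, k) + a 1 * T (1, j, k)

theorem slice_apply (T : TensorIdx n → R) (a : Fin 2 → R) (j k : Fin n) :
    slice T a j k = a 0 * T (0, j, k) + a 1 * T (1, j, k) := rfl

theorem slice_add (T U : TensorIdx n → R) (a : Fin 2 → R) :
    slice (T + U) a = slice T a + slice U a := by
  ext j k
  simp only [slice_apply, Matrix.add_apply, Pi.add_apply]
  ring

theorem slice_smul (c : R) (T : TensorIdx n → R) (a : Fin 2 → R) :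
    slice (c • T) a = c • slice T a := by
  ext j k
  simp only [slice_apply, Matrix.smul_apply, Pi.smul_apply, smul_eq_mul]
  ring

theorem slice_zero (a : Fin 2 → R) : slice (0 : TensorIdx n → R) a = 0 := by
  ext j k
  simp [slice_apply]

theorem slice_sum {ι : Type*} (s : Finset ι) (T : ι → TensorIdx n → R) (a : Fin 2 → R) :
    slice (∑ i ∈ s, T i) a = ∑ i ∈ s, slice (T i) a := by
  induction s using Finset.cons_induction with
  | empty => simp [slice_zero]
  | cons i s hi ih => rw [Finset.sum_cons, Finset.sum_cons, slice_add, ih]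

theorem slice_comb (T : TensorIdx n → R) (x y : R) (p q : Fin 2 → R) :
    slice T (x • p + y • q) = x • slice T p + y • slice T q := by
  ext j k
  simp only [slice_apply, Matrix.add_apply, Matrix.smul_apply, Pi.add_apply, Pi.smul_apply,
    smul_eq_mul]
  ring

theorem slice_smul_right (T : TensorIdx n → R) (x : R) (p : Fin 2 → R) :
    slice T (x • p) = x • slice T p := by
  ext j k
  simp only [slice_apply, Matrix.smul_apply, Pi.smul_apply, smul_eq_mul]
  ring

theorem slice_map {S : Type*} [CommRing S] (f : R →+* S) (T : TensorIdx n → R) (a : Fin 2 → R) :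
    (slice T a).map f = slice (fun x => f (T x)) (fun i => f (a i)) := by
  ext j k
  simp [slice_apply]

theorem eq_of_slice_eq {T U : TensorIdx n → R} (h : ∀ a, slice T a = slice U a) : T = U := by
  ext ⟨i, j, k⟩
  have h0 := congrFun (congrFun (h ![1, 0]) j) k
  have h1 := congrFun (congrFun (h ![0, 1]) j) k
  simp only [slice_apply, cons_val_zero, cons_val_one, one_mul, zero_mul, zero_add,
    add_zero] at h0 h1
  fin_cases i
  · exact h0
  · exact h1

end Slices

section Field

variable {K : Type*} [Field K] {n : ℕ}

/-- Every vector of the plane is a combination of two independent ones. -/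
theorem exists_comb {p q : Fin 2 → K} (hpq : p 0 * q 1 - p 1 * q 0 ≠ 0) (a : Fin 2 → K) :
    ∃ x y : K, a = x • p + y • q := by
  refine ⟨(a 0 * q 1 - a 1 * q 0) / (p 0 * q 1 - p 1 * q 0),
    (p 0 * a 1 - p 1 * a 0) / (p 0 * q 1 - p 1 * q 0), ?_⟩
  ext i
  simp only [Pi.add_apply, Pi.smul_apply, smul_eq_mul]
  rw [div_mul_eq_mul_div, div_mul_eq_mul_div, ← add_div, eq_div_iff hpq]
  fin_cases i
  · simp; ring
  · simp; ring

theorem eq_of_slice_eq_pair {T U : TensorIdx n → K} {p q : Fin 2 → K}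
    (hpq : p 0 * q 1 - p 1 * q 0 ≠ 0) (hp : slice T p = slice U p) (hq : slice T q = slice U q) :
    T = U := by
  refine eq_of_slice_eq fun a => ?_
  obtain ⟨x, y, rfl⟩ := exists_comb hpq a
  rw [slice_comb, slice_comb, hp, hq]

theorem slice_pureTensor (α a : Fin 2 → K) (b c : Fin n → K) :
    slice (pureTensor α b c) a = (α 0 * a 0 + α 1 * a 1) • vecMulVec b c := by
  ext j k
  simp only [slice_apply, pureTensor, Matrix.smul_apply, vecMulVec_apply, smul_eq_mul]
  ring

/-- `T` is a sum of `m` decomposable tensors. -/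
def HasDecomp (m : ℕ) (T : TensorIdx n → K) : Prop :=
  ∃ (α : Fin m → Fin 2 → K) (β γ : Fin m → Fin n → K), T = ∑ i, pureTensor (α i) (β i) (γ i)

theorem slice_sum_pureTensor {m : ℕ} (α : Fin m → Fin 2 → K) (β γ : Fin m → Fin n → K)
    (a : Fin 2 → K) :
    slice (∑ i, pureTensor (α i) (β i) (γ i)) a =
      (Matrix.of β)ᵀ * diagonal (fun i => α i 0 * a 0 + α i 1 * a 1) * Matrix.of γ := by
  ext j k
  rw [slice_sum, Matrix.mul_apply, Matrix.sum_apply]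
  refine Finset.sum_congr rfl fun i _ => ?_
  rw [slice_pureTensor, mul_diagonal]
  simp only [Matrix.smul_apply, vecMulVec_apply, transpose_apply, of_apply, smul_eq_mul]
  ring

theorem hasDecomp_zero (m : ℕ) : HasDecomp m (0 : TensorIdx n → K) := by
  refine ⟨0, 0, 0, ?_⟩
  ext x
  simp [pureTensor, Finset.sum_apply]

theorem HasDecomp.add {m m' : ℕ} {T T' : TensorIdx n → K} (h : HasDecomp m T)
    (h' : HasDecomp m' T') : HasDecomp (m + m') (T + T') := by
  obtain ⟨α, β, γ, rfl⟩ := h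
  obtain ⟨α', β', γ', rfl⟩ := h'
  refine ⟨Fin.append α α', Fin.append β β', Fin.append γ γ', ?_⟩
  rw [Fin.sum_univ_add]
  simp

theorem HasDecomp.mono {m m' : ℕ} {T : TensorIdx n → K} (h : HasDecomp m T) (hm : m ≤ m') :
    HasDecomp m' T := by
  obtain ⟨k, rfl⟩ := Nat.exists_eq_add_of_le hm
  simpa using h.add (hasDecomp_zero k)

theorem hasDecomp_pureTensor (a : Fin 2 → K) (b c : Fin n → K) :
    HasDecomp 1 (pureTensor a b c) :=
  ⟨fun _ => a, fun _ => b, fun _ => c, by simp⟩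

theorem HasDecomp.smul {m : ℕ} {T : TensorIdx n → K} (h : HasDecomp m T) (c : K) :
    HasDecomp m (c • T) := by
  obtain ⟨α, β, γ, rfl⟩ := h
  refine ⟨fun i => c • α i, β, γ, ?_⟩
  rw [Finset.smul_sum]
  refine Finset.sum_congr rfl fun i _ => ?_
  ext x
  simp only [pureTensor, Pi.smul_apply, smul_eq_mul]
  ring

theorem hasDecomp_sum {ι : Type*} (s : Finset ι) (T : ι → TensorIdx n → K)
    (h : ∀ i ∈ s, HasDecomp 1 (T i)) : HasDecomp s.card (∑ i ∈ s, T i) := by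
  classical
  induction s using Finset.induction_on with
  | empty => simpa using hasDecomp_zero 0
  | insert i s hi ih =>
    rw [Finset.sum_insert hi, Finset.card_insert_of_notMem hi, add_comm s.card]
    exact (h i (Finset.mem_insert_self _ _)).add
      (ih fun j hj => h j (Finset.mem_insert_of_mem hj))

/-- Each slice of a sum of `m` decomposable tensors factors through `K^m`. -/
theorem le_of_hasDecomp {m : ℕ} {T : TensorIdx n → K} (h : HasDecomp m T) {a : Fin 2 → K}
    (ha : (slice T a).det ≠ 0) : n ≤ m := by
  obtain ⟨α, β, γ, rfl⟩ := h
  have h1 := rank_of_isUnit _ ((isUnit_iff_isUnit_det _).2 (isUnit_iff_ne_zero.2 ha))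
  rw [slice_sum_pureTensor, Fintype.card_fin] at h1
  rw [← h1]
  refine (rank_mul_le_right _ _).trans ?_
  exact (rank_le_height (Matrix.of γ))

/-! ## The rank with respect to the Segre variety -/

/-- This replaces spans of distinct points by plain sums, which may contain zero or proportional
terms: such terms are dropped or merged on passing to points, and a vector on the line of a Segre
point is again decomposable. -/
theorem xRank_le_iff {m : ℕ} {T : TensorIdx n → K} (hT : T ≠ 0) :
    xRank (segre K n) (Projectivization.mk K T hT) ≤ m ↔ HasDecomp m T := by
  classical
  constructor
  · intro h
    -- A strict bound on the infimum is what produces an actual set of points.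
    have h' : xRank (segre K n) (Projectivization.mk K T hT) < (m + 1 : ℕ) :=
      lt_of_le_of_lt h (by exact_mod_cast Nat.lt_succ_self m)
    simp only [xRank, iInf_lt_iff] at h'
    obtain ⟨S, ⟨hS, hf⟩, hc⟩ := h'
    have hc' : S.card ≤ m := Nat.lt_succ_iff.1 (by exact_mod_cast hc)
    have hmem : T ∈ ⨆ p ∈ S, p.submodule := by
      apply hf
      rw [Projectivization.submodule_mk]
      exact Submodule.mem_span_singleton_self T
    rw [Submodule.mem_iSup_finset_iff_exists_sum] at hmem
    obtain ⟨v, hv⟩ := hmem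
    rw [← hv]
    refine (hasDecomp_sum S _ fun p hp => ?_).mono hc'
    obtain ⟨a, b, c, hne, hpe⟩ := hS hp
    have hvp : (v p : TensorIdx n → K) ∈ p.submodule := (v p).2
    generalize (v p : TensorIdx n → K) = u at hvp
    rw [hpe, Projectivization.submodule_mk] at hvp
    obtain ⟨t, rfl⟩ := Submodule.mem_span_singleton.1 hvp
    exact (hasDecomp_pureTensor a b c).smul t
  · rintro ⟨α, β, γ, hsum⟩
    let I := Finset.univ.filter fun i => pureTensor (α i) (β i) (γ i) ≠ 0
    have hI : ∀ i : I, pureTensor (α i) (β i) (γ i) ≠ 0 := fun i => (Finset.mem_filter.1 i.2).2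
    let S : Finset (ℙ K (TensorIdx n → K)) :=
      Finset.univ.image fun i : I => Projectivization.mk K _ (hI i)
    have hcard : S.card ≤ m := by
      refine Finset.card_image_le.trans ?_
      rw [Finset.card_univ, Fintype.card_coe]
      exact (Finset.card_le_univ I).trans (by simp)
    refine (iInf₂_le S ⟨?_, ?_⟩).trans (by exact_mod_cast hcard)
    · intro p hp
      obtain ⟨i, -, rfl⟩ := Finset.mem_image.1 (Finset.mem_coe.1 hp)
      exact ⟨_, _, _, hI i, rfl⟩
    · rw [Projectivization.submodule_mk, Submodule.span_singleton_le_iff_mem]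
      rw [hsum]
      refine Submodule.sum_mem _ fun i _ => ?_
      by_cases hi : pureTensor (α i) (β i) (γ i) = 0
      · rw [hi]; exact Submodule.zero_mem _
      · have hiI : i ∈ I := Finset.mem_filter.2 ⟨Finset.mem_univ _, hi⟩
        have hpS : Projectivization.mk K _ hi ∈ S :=
          Finset.mem_image.2 ⟨⟨i, hiI⟩, Finset.mem_univ _, rfl⟩
        refine (le_iSup₂_of_le (f := fun (p : ℙ K (TensorIdx n → K)) (_ : p ∈ S) => p.submodule)
          _ hpS le_rfl) ?_
        rw [Projectivization.submodule_mk]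
        exact Submodule.mem_span_singleton_self _

theorem xRank_eq {T : TensorIdx n → K} (hT : T ≠ 0) (h : HasDecomp n T) {a : Fin 2 → K}
    (ha : (slice T a).det ≠ 0) :
    xRank (segre K n) (Projectivization.mk K T hT) = n := by
  refine le_antisymm ((xRank_le_iff hT).2 h) ?_
  by_contra hlt
  obtain ⟨m, hm⟩ := ENat.ne_top_iff_exists.1 (lt_of_not_ge hlt).ne_top
  have h1 : m < n := by
    rw [← hm] at hlt
    exact_mod_cast lt_of_not_ge hlt
  have h2 := le_of_hasDecomp ((xRank_le_iff hT).1 hm.symm.le) ha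
  omega

theorem hasDecomp_of_xRank_eq {m : ℕ} {T : TensorIdx n → K} (hT : T ≠ 0)
    (h : xRank (segre K n) (Projectivization.mk K T hT) = m) : HasDecomp m T :=
  (xRank_le_iff hT).1 h.le

/-! ## Pencils with a basis of generalized eigenvectors -/

/-- With `P`, `Q` the slices at `p`, `q`, one has `P = (PW) W⁻¹` and `Q = (PW) D W⁻¹`. The planar
vectors in the witness solve, by Cramer's rule, `α · p = 1` and `α · q = d i`. Invertibility of `P`
is not needed. -/
theorem hasDecomp_of_mul_diagonal {T : TensorIdx n → K} {p q : Fin 2 → K}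
    (hpq : p 0 * q 1 - p 1 * q 0 ≠ 0) {W : Matrix (Fin n) (Fin n) K} (hW : W.det ≠ 0)
    {d : Fin n → K} (h : slice T q * W = slice T p * W * diagonal d) : HasDecomp n T := by
  have hu : IsUnit W.det := isUnit_iff_ne_zero.2 hW
  refine ⟨fun i => ![(q 1 - d i * p 1) / (p 0 * q 1 - p 1 * q 0),
    (d i * p 0 - q 0) / (p 0 * q 1 - p 1 * q 0)], fun i j => (slice T p * W) j i,
    fun i j => W⁻¹ i j, ?_⟩
  refine eq_of_slice_eq_pair hpq ?_ ?_
  · rw [slice_sum_pureTensor]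
    have : (fun i => (![(q 1 - d i * p 1) / (p 0 * q 1 - p 1 * q 0),
      (d i * p 0 - q 0) / (p 0 * q 1 - p 1 * q 0)] : Fin 2 → K) 0 * p 0 +
      (![(q 1 - d i * p 1) / (p 0 * q 1 - p 1 * q 0),
      (d i * p 0 - q 0) / (p 0 * q 1 - p 1 * q 0)] : Fin 2 → K) 1 * p 1) = fun _ => 1 := by
      ext i
      simp only [cons_val_zero, cons_val_one]
      rw [div_mul_eq_mul_div, div_mul_eq_mul_div, ← add_div, div_eq_one_iff_eq hpq]
      ring
    rw [this, diagonal_one, mul_one]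
    change _ = (slice T p * W)ᵀᵀ * W⁻¹
    rw [transpose_transpose, mul_assoc, mul_nonsing_inv _ hu, mul_one]
  · rw [slice_sum_pureTensor]
    have : (fun i => (![(q 1 - d i * p 1) / (p 0 * q 1 - p 1 * q 0),
      (d i * p 0 - q 0) / (p 0 * q 1 - p 1 * q 0)] : Fin 2 → K) 0 * q 0 +
      (![(q 1 - d i * p 1) / (p 0 * q 1 - p 1 * q 0),
      (d i * p 0 - q 0) / (p 0 * q 1 - p 1 * q 0)] : Fin 2 → K) 1 * q 1) = d := by
      ext i
      simp only [cons_val_zero, cons_val_one]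
      rw [div_mul_eq_mul_div, div_mul_eq_mul_div, ← add_div, div_eq_iff hpq]
      ring
    rw [this]
    change _ = (slice T p * W)ᵀᵀ * diagonal d * W⁻¹
    rw [transpose_transpose, ← h, mul_assoc, mul_nonsing_inv _ hu, mul_one]

/-- A regular pencil with `n` distinct roots is a sum of `n` decomposable tensors. -/
theorem hasDecomp_of_roots {T : TensorIdx n → K} {p q : Fin 2 → K}
    (hpq : p 0 * q 1 - p 1 * q 0 ≠ 0) {a : Fin 2 → K} (ha : (slice T a).det ≠ 0)
    {l : Fin n → K} (hl : Function.Injective l)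
    (hdet : ∀ i, (l i • slice T p + slice T q).det = 0) : HasDecomp n T := by
  have hw : ∀ i, ∃ w : Fin n → K, w ≠ 0 ∧ (l i • slice T p + slice T q) *ᵥ w = 0 :=
    fun i => exists_mulVec_eq_zero_iff.2 (hdet i)
  choose w hw0 hw using hw
  obtain ⟨x, y, rfl⟩ := exists_comb hpq a
  set P := slice T p with hP
  set Q := slice T q with hQ
  rw [slice_comb] at ha
  set G := x • P + y • Q with hG
  have hu : IsUnit G.det := isUnit_iff_ne_zero.2 ha
  have hQw : ∀ i, Q *ᵥ w i = -(l i) • (P *ᵥ w i) := by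
    intro i
    have := hw i
    rw [add_mulVec, smul_mulVec] at this
    rw [neg_smul]
    exact eq_neg_of_add_eq_zero_right this
  have hGw : ∀ i, G *ᵥ w i = (x - y * l i) • (P *ᵥ w i) := by
    intro i
    rw [hG, add_mulVec, smul_mulVec, smul_mulVec, hQw, smul_smul, ← add_smul]
    congr 1
    ring
  have hGne : ∀ i, G *ᵥ w i ≠ 0 := fun i h0 => ha (exists_mulVec_eq_zero_iff.1 ⟨w i, hw0 i, h0⟩)
  have hne : ∀ i, x - y * l i ≠ 0 := by
    intro i h0
    apply hGne i
    rw [hGw, h0, zero_smul]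
  have heig : ∀ i, Module.End.HasEigenvector (Matrix.toLin' (G⁻¹ * P)) ((x - y * l i)⁻¹) (w i) := by
    intro i
    rw [Module.End.hasEigenvector_iff, Module.End.mem_eigenspace_iff]
    refine ⟨?_, hw0 i⟩
    have h1 : P *ᵥ w i = (x - y * l i)⁻¹ • (G *ᵥ w i) := by
      rw [hGw, smul_smul, inv_mul_cancel₀ (hne i), one_smul]
    rw [toLin'_apply, ← mulVec_mulVec, h1, mulVec_smul, mulVec_mulVec, nonsing_inv_mul _ hu,
      one_mulVec]
  -- The `w i` are eigenvectors of `G⁻¹ P` with eigenvalues `(x - y l i)⁻¹`, distinct only if `y ≠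
  -- 0`. If `y = 0`, then `P` itself is invertible and `P⁻¹ Q` has the distinct eigenvalues `-l i`.
  have hli : LinearIndependent K w := by
    rcases eq_or_ne y 0 with hy | hy
    · have hPu : IsUnit P.det := by
        rw [hG, hy, zero_smul, add_zero, det_smul] at ha
        exact isUnit_iff_ne_zero.2 (right_ne_zero_of_mul ha)
      refine Module.End.eigenvectors_linearIndependent' (Matrix.toLin' (P⁻¹ * Q))
        (fun i => -(l i)) (fun i j hij => hl (neg_injective hij)) w fun i => ?_
      rw [Module.End.hasEigenvector_iff, Module.End.mem_eigenspace_iff]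
      refine ⟨?_, hw0 i⟩
      rw [toLin'_apply, ← mulVec_mulVec, hQw, mulVec_smul, mulVec_mulVec,
        nonsing_inv_mul _ hPu, one_mulVec]
    · refine Module.End.eigenvectors_linearIndependent' _ _ (fun i j hij => hl ?_) w heig
      have := inv_injective hij
      exact mul_left_cancel₀ hy (sub_right_injective this)
  have hW : (Matrix.of w)ᵀ.det ≠ 0 := by
    rw [det_transpose]
    exact isUnit_iff_ne_zero.1 ((isUnit_iff_isUnit_det _).1
      (linearIndependent_rows_iff_isUnit.1 hli))
  refine hasDecomp_of_mul_diagonal hpq hW (d := fun i => -(l i)) ?_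
  ext j i
  rw [mul_diagonal]
  have h1 := congrFun (hQw i) j
  rw [Pi.smul_apply, smul_eq_mul] at h1
  have h2 : (Q * (Matrix.of w)ᵀ) j i = (Q *ᵥ w i) j := rfl
  have h3 : (P * (Matrix.of w)ᵀ) j i = (P *ᵥ w i) j := rfl
  rw [h2, h3, h1, mul_comm]

end Field

/-! ## Open sets of real projective space -/

section Topology

variable {ι : Type*}

theorem isOpen_setOf_mk_mem {U : Set (ℙ ℝ (ι → ℝ))} (hU : IsOpen U) :
    IsOpen {v : ι → ℝ | ∃ h : v ≠ 0, Projectivization.mk ℝ v h ∈ U} := by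
  have h1 : IsOpen {v : {v : ι → ℝ // v ≠ 0} | Projectivization.mk ℝ v.1 v.2 ∈ U} :=
    hU.preimage (continuous_quotient_mk' (s := projectivizationSetoid ℝ (ι → ℝ)))
  have h2 : IsOpen {v : ι → ℝ | v ≠ 0} := isOpen_ne
  convert h2.isOpenMap_subtype_val _ h1 using 1
  ext v
  simp only [Set.mem_ofPred_eq, Set.mem_image, Subtype.exists]
  constructor
  · rintro ⟨h, hv⟩
    exact ⟨v, h, hv, rfl⟩
  · rintro ⟨w, h, hw, rfl⟩
    exact ⟨h, hw⟩

/-- A property of vectors that is invariant under scaling. -/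
def ScaleInvariant (P : (ι → ℝ) → Prop) : Prop := ∀ (c : ℝ) (v : ι → ℝ), c ≠ 0 → (P (c • v) ↔ P v)

theorem ScaleInvariant.rep_iff {P : (ι → ℝ) → Prop} (hP : ScaleInvariant P) {v : ι → ℝ}
    (hv : v ≠ 0) : P (Projectivization.mk ℝ v hv).rep ↔ P v := by
  obtain ⟨a, ha⟩ := Projectivization.exists_smul_eq_mk_rep ℝ v hv
  rw [← ha]
  exact hP a v a.ne_zero

theorem ScaleInvariant.isOpen {P : (ι → ℝ) → Prop} (hP : ScaleInvariant P)
    (h : IsOpen {v | P v}) : IsOpen {p : ℙ ℝ (ι → ℝ) | P p.rep} := by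
  have h1 : Topology.IsQuotientMap (Quotient.mk (projectivizationSetoid ℝ (ι → ℝ))) :=
    isQuotientMap_quotient_mk'
  -- Stated on the quotient, where the quotient-map criterion applies; scale invariance makes the
  -- chosen representative irrelevant.
  have key : IsOpen (X := Quotient (projectivizationSetoid ℝ (ι → ℝ)))
      {p | P (Projectivization.rep (K := ℝ) (V := ι → ℝ) p)} := by
    rw [← h1.isOpen_preimage]
    convert h.preimage continuous_subtype_val using 1
    ext v
    exact hP.rep_iff v.2
  exact key

end Topology

/-! ## Determinantal polynomials of pencils and their double roots -/

section Pencil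

open Polynomial

variable {n : ℕ}

/-- The polynomial `det (X A + B)`. -/
noncomputable def pencilPoly {R : Type*} [CommRing R] (A B : Matrix (Fin n) (Fin n) R) : R[X] :=
  det ((X : R[X]) • A.map C + B.map C)

section CommRing

variable {R : Type*} [CommRing R]

theorem eval_pencilPoly (A B : Matrix (Fin n) (Fin n) R) (t : R) :
    (pencilPoly A B).eval t = (t • A + B).det := by
  rw [pencilPoly, ← coe_evalRingHom, RingHom.map_det]
  congr 1
  ext i j
  simp
  ring

theorem natDegree_pencilPoly_le (A B : Matrix (Fin n) (Fin n) R) :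
    (pencilPoly A B).natDegree ≤ n := by
  simpa [pencilPoly] using natDegree_det_X_add_C_le A B

theorem coeff_pencilPoly_zero (A B : Matrix (Fin n) (Fin n) R) :
    (pencilPoly A B).coeff 0 = B.det := coeff_det_X_add_C_zero A B

theorem coeff_pencilPoly_card (A B : Matrix (Fin n) (Fin n) R) :
    (pencilPoly A B).coeff n = A.det := by
  simpa [pencilPoly] using coeff_det_X_add_C_card A B

theorem pencilPoly_map {S : Type*} [CommRing S] (φ : R →+* S) (A B : Matrix (Fin n) (Fin n) R) :
    (pencilPoly A B).map φ = pencilPoly (A.map φ) (B.map φ) := by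
  rw [pencilPoly, ← coe_mapRingHom, RingHom.map_det, pencilPoly]
  congr 1
  ext i j : 1
  simp

/-- Moves a root at `t` to `0`, so that a double root means that coefficients `0` and `1` vanish. -/
theorem taylor_pencilPoly (A B : Matrix (Fin n) (Fin n) R) (t : R) :
    taylor t (pencilPoly A B) = pencilPoly A (t • A + B) := by
  change taylorAlgHom t _ = _
  rw [pencilPoly, AlgHom.map_det, pencilPoly]
  congr 1
  ext i j : 1
  simp only [AlgHom.mapMatrix_apply, Matrix.map_apply, Matrix.add_apply, Matrix.smul_apply,
    smul_eq_mul, taylorAlgHom_apply, map_add, taylor_mul, taylor_X, taylor_C, C_mul]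
  ring

end CommRing

variable {K : Type*} [Field K]

/-- If `b` is in the left kernel of `N`, the linear coefficient of `det (X A + N)` is, up to a
factor, the determinant of `N` with one row replaced by `b A`. -/
theorem mul_coeff_one_pencilPoly {A N : Matrix (Fin n) (Fin n) K} {b : Fin n → K}
    (hb : b ᵥ* N = 0) (i : Fin n) :
    b i * (pencilPoly A N).coeff 1 = (N.updateRow i (b ᵥ* A)).det := by
  have h1 := det_updateRow_sum ((X : K[X]) • A.map C + N.map C) i (fun k => C (b k))
  have h2 : ∑ k, C (b k) • ((X : K[X]) • A.map C + N.map C) k =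
      (X : K[X]) • fun j => C ((b ᵥ* A) j) := by
    ext1 j
    have h3 : ∑ k, b k * N k j = 0 := congrFun hb j
    simp only [Finset.sum_apply, Pi.smul_apply, Matrix.add_apply, Matrix.smul_apply, smul_eq_mul,
      Matrix.map_apply, mul_add, Finset.sum_add_distrib, ← C_mul, ← map_sum, h3, map_zero, add_zero,
      vecMul, dotProduct]
    rw [map_sum, Finset.mul_sum]
    refine Finset.sum_congr rfl fun k _ => ?_
    rw [C_mul]
    ring
  rw [h2, det_updateRow_smul, smul_eq_mul] at h1
  have h4 := congrArg (fun P : K[X] => P.coeff 1) h1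
  simp only [coeff_X_mul, coeff_C_mul] at h4
  change _ = b i * (pencilPoly A N).coeff 1 at h4
  rw [← h4, coeff_zero_eq_eval_zero, ← coe_evalRingHom, RingHom.map_det]
  congr 1
  ext k j
  by_cases hk : k = i
  · subst hk
    simp
  · simp [hk]

/-- Take `b ≠ 0` in the left kernel of `N`, with `b i ≠ 0`. The linear coefficient vanishes iff `N`
with row `i` replaced by `b A` is singular. A kernel vector `c` of that matrix kills the other rows
of `N`, hence also row `i` because `b N = 0`, and the replaced row says `b A c = 0`. The argument
does not depend on the corank of `N`. -/
theorem coeff_pencilPoly_eq_zero_iff {A N : Matrix (Fin n) (Fin n) K} :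
    ((pencilPoly A N).coeff 0 = 0 ∧ (pencilPoly A N).coeff 1 = 0) ↔
      ∃ b c : Fin n → K, b ≠ 0 ∧ c ≠ 0 ∧ N *ᵥ c = 0 ∧ b ᵥ* N = 0 ∧ b ⬝ᵥ A *ᵥ c = 0 := by
  constructor
  · rintro ⟨h0, h1⟩
    rw [coeff_pencilPoly_zero] at h0
    obtain ⟨b, hb0, hb⟩ := exists_vecMul_eq_zero_iff.2 h0
    obtain ⟨i, hi⟩ := Function.ne_iff.1 hb0
    have h2 := mul_coeff_one_pencilPoly (A := A) hb i
    rw [h1, mul_zero] at h2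
    obtain ⟨c, hc0, hc⟩ := exists_mulVec_eq_zero_iff.2 h2.symm
    have hrow : ∀ k, k ≠ i → (N *ᵥ c) k = 0 := by
      intro k hk
      have := congrFun hc k
      simpa [mulVec, updateRow_ne hk] using this
    refine ⟨b, c, hb0, hc0, ?_, hb, ?_⟩
    · have h3 : b ⬝ᵥ N *ᵥ c = 0 := by rw [dotProduct_mulVec, hb, zero_dotProduct]
      rw [dotProduct, Finset.sum_eq_single i (fun k _ hk => by rw [hrow k hk, mul_zero])
        (by simp)] at h3
      ext k
      by_cases hk : k = i
      · subst hk
        exact (mul_eq_zero.1 h3).resolve_left hi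
      · exact hrow k hk
    · have := congrFun hc i
      rw [dotProduct_mulVec]
      simpa [mulVec] using this
  · rintro ⟨b, c, hb0, hc0, hNc, hbN, hbc⟩
    have h0 : N.det = 0 := exists_mulVec_eq_zero_iff.1 ⟨c, hc0, hNc⟩
    refine ⟨by rw [coeff_pencilPoly_zero, h0], ?_⟩
    obtain ⟨i, hi⟩ := Function.ne_iff.1 hb0
    have h2 := mul_coeff_one_pencilPoly (A := A) hbN i
    have h3 : (N.updateRow i (b ᵥ* A)).det = 0 := by
      refine exists_mulVec_eq_zero_iff.1 ⟨c, hc0, ?_⟩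
      ext k
      by_cases hk : k = i
      · subst hk
        rw [dotProduct_mulVec] at hbc
        simpa [mulVec] using hbc
      · have := congrFun hNc k
        simpa [mulVec, updateRow_ne hk] using this
    rw [h3] at h2
    exact (mul_eq_zero.1 h2).resolve_left hi

/-- Exchanging the two matrices reverses the coefficients; this is how a root at infinity is brought
to `0`. -/
theorem reflect_pencilPoly [Infinite K] (A B : Matrix (Fin n) (Fin n) K) :
    reflect n (pencilPoly A B) = pencilPoly B A := by
  refine eq_of_infinite_eval_eq _ _ ((Set.finite_singleton (0 : K)).infinite_compl.mono ?_)
  intro x hx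
  have hx0 : x ≠ 0 := hx
  let _ := invertibleOfNonzero (inv_ne_zero hx0)
  have h := eval₂_reflect_mul_pow (RingHom.id K) x⁻¹ n (pencilPoly A B)
    (natDegree_pencilPoly_le A B)
  simp only [invOf_eq_inv, inv_inv, eval₂_id, eval_pencilPoly] at h
  change (reflect n (pencilPoly A B)).eval x = (pencilPoly B A).eval x
  have h1 : x • B + A = x • (x⁻¹ • A + B) := by
    rw [smul_add, smul_smul, mul_inv_cancel₀ hx0, one_smul, add_comm]
  rw [eval_pencilPoly, h1, det_smul, Fintype.card_fin, ← h, inv_pow, mul_comm, mul_assoc,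
    inv_mul_cancel₀ (pow_ne_zero n hx0), mul_one]

theorem coeff_pencilPoly_swap [Infinite K] (A B : Matrix (Fin n) (Fin n) K) {k : ℕ} (hk : k ≤ n) :
    (pencilPoly B A).coeff k = (pencilPoly A B).coeff (n - k) := by
  rw [← reflect_pencilPoly A B, coeff_reflect, revAt_le hk]

/-! ## Tensors whose hyperplane is tangent to the Segre variety -/

/-- The hyperplane defined by `T` is tangent to the Segre variety. -/
def IsTangent (T : TensorIdx n → K) : Prop :=
  ∃ (a : Fin 2 → K) (b c : Fin n → K), a ≠ 0 ∧ b ≠ 0 ∧ c ≠ 0 ∧ slice T a *ᵥ c = 0 ∧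
    b ᵥ* slice T a = 0 ∧ ∀ a', b ⬝ᵥ slice T a' *ᵥ c = 0

theorem isTangent_of_coeff {T : TensorIdx n → K} {p q : Fin 2 → K}
    (hpq : p 0 * q 1 - p 1 * q 0 ≠ 0) (h0 : (pencilPoly (slice T q) (slice T p)).coeff 0 = 0)
    (h1 : (pencilPoly (slice T q) (slice T p)).coeff 1 = 0) : IsTangent T := by
  obtain ⟨b, c, hb, hc, hNc, hbN, hbc⟩ := coeff_pencilPoly_eq_zero_iff.1 ⟨h0, h1⟩
  refine ⟨p, b, c, ?_, hb, hc, hNc, hbN, fun a' => ?_⟩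
  · rintro rfl
    simp at hpq
  · obtain ⟨x, y, rfl⟩ := exists_comb hpq a'
    rw [slice_comb, add_mulVec, dotProduct_add, smul_mulVec, smul_mulVec, hNc, smul_zero,
      dotProduct_zero, dotProduct_smul, hbc, smul_zero, add_zero]

theorem isTangent_of_double_root {T : TensorIdx n → K} {p q : Fin 2 → K}
    (hpq : p 0 * q 1 - p 1 * q 0 ≠ 0) {t : K}
    (h0 : (pencilPoly (slice T p) (slice T q)).eval t = 0)
    (h1 : (pencilPoly (slice T p) (slice T q)).derivative.eval t = 0) : IsTangent T := by
  have h2 : slice T (t • p + (1 : K) • q) = t • slice T p + slice T q := by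
    rw [slice_comb, one_smul]
  refine isTangent_of_coeff (p := t • p + (1 : K) • q) (q := p) ?_ ?_ ?_
  · intro h
    apply hpq
    simp only [Pi.add_apply, Pi.smul_apply, smul_eq_mul] at h
    linear_combination -h
  · rw [h2, ← taylor_pencilPoly, taylor_coeff_zero, h0]
  · rw [h2, ← taylor_pencilPoly, taylor_coeff_one, h1]

theorem IsTangent.exists_coeff {T : TensorIdx n → K} (h : IsTangent T) :
    ∃ a : Fin 2 → K, a ≠ 0 ∧ ∀ q, (pencilPoly (slice T q) (slice T a)).coeff 0 = 0 ∧
      (pencilPoly (slice T q) (slice T a)).coeff 1 = 0 := by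
  obtain ⟨a, b, c, ha, hb, hc, hNc, hbN, hbc⟩ := h
  exact ⟨a, ha, fun q => coeff_pencilPoly_eq_zero_iff.2 ⟨b, c, hb, hc, hNc, hbN, hbc q⟩⟩

/-- A tensor that is not tangent has a regular pencil. -/
theorem exists_det_slice_ne_zero [Infinite K] {T : TensorIdx n → K}
    (h : pencilPoly (slice T ![0, 1]) (slice T ![1, 0]) ≠ 0) :
    ∃ t : K, (slice T ![1, t]).det ≠ 0 := by
  by_contra hcon
  push Not at hcon
  apply h
  refine Polynomial.funext fun t => ?_
  rw [eval_pencilPoly, eval_zero]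
  refine Eq.trans ?_ (hcon t)
  congr 1
  ext j k
  simp only [slice_apply, Matrix.add_apply, Matrix.smul_apply, smul_eq_mul, cons_val_zero,
    cons_val_one]
  ring

theorem pencilPoly_ne_zero_of_not_isTangent {T : TensorIdx n → K} (h : ¬ IsTangent T) :
    pencilPoly (slice T ![0, 1]) (slice T ![1, 0]) ≠ 0 := by
  intro h0
  refine h (isTangent_of_coeff (p := ![1, 0]) (q := ![0, 1]) (by simp) ?_ ?_) <;>
    rw [h0, coeff_zero]

/-- Invertibility of the slice at `p` excludes a root at infinity, so the degree is exactly `n`; a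
repeated root would be a point of tangency. -/
theorem exists_roots_of_not_isTangent [IsAlgClosed K] {T : TensorIdx n → K}
    (h : ¬ IsTangent T) {p q : Fin 2 → K} (hpq : p 0 * q 1 - p 1 * q 0 ≠ 0)
    (hp : (slice T p).det ≠ 0) :
    ∃ l : Fin n → K, Function.Injective l ∧ ∀ i, (l i • slice T p + slice T q).det = 0 := by
  classical
  set g := pencilPoly (slice T p) (slice T q) with hg
  have hcoeff : g.coeff n ≠ 0 := by rwa [hg, coeff_pencilPoly_card]
  have hg0 : g ≠ 0 := by
    rintro h0
    rw [h0, coeff_zero] at hcoeff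
    exact hcoeff rfl
  have hdeg : g.natDegree = n :=
    le_antisymm (natDegree_pencilPoly_le _ _) (le_natDegree_of_ne_zero hcoeff)
  have hnodup : g.roots.Nodup := by
    rw [Multiset.nodup_iff_count_le_one]
    intro t
    rw [count_roots]
    by_contra hlt
    obtain ⟨h0, h1⟩ := (one_lt_rootMultiplicity_iff_isRoot hg0).1 (not_le.1 hlt)
    exact h (isTangent_of_double_root hpq h0 h1)
  have hcard : g.roots.toFinset.card = n := by
    rw [Multiset.toFinset_card_of_nodup hnodup, ← (IsAlgClosed.splits g).natDegree_eq_card_roots,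
      hdeg]
  refine ⟨fun i => (g.roots.toFinset.equivFinOfCardEq hcard).symm i, ?_, fun i => ?_⟩
  · intro i j hij
    exact (g.roots.toFinset.equivFinOfCardEq hcard).symm.injective (Subtype.ext hij)
  · have hmem := ((g.roots.toFinset.equivFinOfCardEq hcard).symm i).2
    rw [Multiset.mem_toFinset, mem_roots hg0, IsRoot.def] at hmem
    exact (eval_pencilPoly _ _ _).symm.trans hmem

theorem hasDecomp_of_not_isTangent [IsAlgClosed K] {T : TensorIdx n → K} (h : ¬ IsTangent T) :
    HasDecomp n T ∧ ∃ a, (slice T a).det ≠ 0 := by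
  obtain ⟨t, ht⟩ := exists_det_slice_ne_zero (pencilPoly_ne_zero_of_not_isTangent h)
  have hpq : (![1, t] : Fin 2 → K) 0 * (![0, 1] : Fin 2 → K) 1 -
      (![1, t] : Fin 2 → K) 1 * (![0, 1] : Fin 2 → K) 0 ≠ 0 := by simp
  obtain ⟨l, hl, hdet⟩ := exists_roots_of_not_isTangent h hpq ht
  exact ⟨hasDecomp_of_roots hpq ht hl hdet, _, ht⟩

end Pencil

/-! ## The resultant with formal degrees -/

section Resultant

open Polynomial

/-- With formal degrees the resultant detects common zeros on the projective line: at infinity,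
where both top coefficients vanish, or at finite points, where coprimality fails. -/
theorem resultant_formal_eq_zero_iff {K : Type*} [Field K] {f g : K[X]} {m : ℕ} (hm : 0 < m)
    (hf : f.natDegree ≤ m) (hg : g.natDegree ≤ m) :
    resultant f g m m = 0 ↔ (f.coeff m = 0 ∧ g.coeff m = 0) ∨ ¬ IsCoprime f g := by
  have hlt : ∀ h : K[X], h.natDegree ≤ m → h.coeff m = 0 → h.natDegree < m := by
    intro h h1 h2
    refine lt_of_le_of_ne h1 fun h3 => ?_
    rw [← h3, coeff_natDegree, leadingCoeff_eq_zero] at h2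
    rw [h2, natDegree_zero] at h3
    omega
  have key : ∀ f g : K[X], f.natDegree ≤ m → g.natDegree ≤ m → f.coeff m ≠ 0 →
      (resultant f g m m = 0 ↔ ¬ IsCoprime f g) := by
    intro f g hf hg h
    have hf0 : f ≠ 0 := by
      rintro rfl
      exact h (coeff_zero _)
    have hdeg : f.natDegree = m := le_antisymm hf (le_natDegree_of_ne_zero h)
    obtain ⟨k, hk⟩ := Nat.exists_eq_add_of_le hg
    -- Padding the degree of `g` only multiplies the resultant by a power of the top coefficient of
    -- `f`, which is nonzero.
    have h1 := resultant_add_right_deg f g m g.natDegree k le_rfl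
    rw [← hk] at h1
    rw [h1, mul_eq_zero, or_iff_right (pow_ne_zero k h)]
    conv_lhs => rw [← hdeg]
    rw [resultant_eq_zero_iff]
    simp [hf0]
  by_cases h1 : f.coeff m = 0
  · by_cases h2 : g.coeff m = 0
    · simp [h1, h2, resultant_eq_zero_of_lt_lt f g m m (hlt f hf h1) (hlt g hg h2)]
    · rw [resultant_comm, mul_eq_zero, or_iff_right (pow_ne_zero _ (neg_ne_zero.2 one_ne_zero)),
        key g f hg hf h2, isCoprime_comm]
      simp [h2]
  · rw [key f g hf hg h1]
    simp [h1]

/-- The resultant of the two partial derivatives of the binary form of degree `n` with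
dehomogenization `f`. -/
noncomputable def formDiscr {R : Type*} [CommRing R] (n : ℕ) (f : R[X]) : R :=
  resultant (derivative f) (C (n : R) * f - X * derivative f) (n - 1) (n - 1)

theorem formDiscr_map {R S : Type*} [CommRing R] [CommRing S] (φ : R →+* S) (n : ℕ) (f : R[X]) :
    φ (formDiscr n f) = formDiscr n (f.map φ) := by
  have h := resultant_map_map (derivative f) (C (n : R) * f - X * derivative f) (n - 1) (n - 1) φ
  rw [formDiscr, ← h, formDiscr]
  congr 1 <;> simp

/-- By Euler's relation in characteristic zero, the common zeros of the two partial derivatives are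
the multiple roots of the binary form. The first alternative is a multiple root at infinity. -/
theorem formDiscr_eq_zero_iff {K : Type*} [Field K] [IsAlgClosed K] [CharZero K] {n : ℕ}
    (hn : 2 ≤ n) {f : K[X]} (hf : f.natDegree ≤ n) :
    formDiscr n f = 0 ↔ (f.coeff n = 0 ∧ f.coeff (n - 1) = 0) ∨
      ∃ t, f.eval t = 0 ∧ f.derivative.eval t = 0 := by
  obtain ⟨m, rfl⟩ : ∃ m, n = m + 2 := ⟨n - 2, by omega⟩
  have hn0 : ((m + 2 : ℕ) : K) ≠ 0 := Nat.cast_ne_zero.2 (by omega)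
  -- The factor vanishes in degree `n`, which gives the degree bound `n - 1`, and equals `1` in
  -- degree `n - 1`.
  have hcoeff : ∀ k : ℕ, (C ((m + 2 : ℕ) : K) * f - X * derivative f).coeff (k + 1) =
      (((m + 2 : ℕ) : K) - ((k : K) + 1)) * f.coeff (k + 1) := by
    intro k
    rw [coeff_sub, coeff_C_mul, coeff_X_mul, coeff_derivative]
    ring
  rw [formDiscr, resultant_formal_eq_zero_iff (by omega)]
  · have h1 : (derivative f).coeff (m + 2 - 1) = 0 ↔ f.coeff (m + 2) = 0 := by
      change (derivative f).coeff (m + 1) = 0 ↔ _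
      rw [coeff_derivative, mul_eq_zero, or_iff_left]
      exact_mod_cast hn0
    have h2 : (C ((m + 2 : ℕ) : K) * f - X * derivative f).coeff (m + 2 - 1) = 0 ↔
        f.coeff (m + 2 - 1) = 0 := by
      change (C ((m + 2 : ℕ) : K) * f - X * derivative f).coeff (m + 1) = 0 ↔ f.coeff (m + 1) = 0
      rw [hcoeff]
      have : ((m + 2 : ℕ) : K) - ((m : K) + 1) = 1 := by push_cast; ring
      rw [this, one_mul]
    rw [h1, h2, Polynomial.isCoprime_iff_aeval_ne_zero_of_isAlgClosed K K]
    push Not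
    refine or_congr Iff.rfl (exists_congr fun t => ?_)
    simp only [coe_aeval_eq_eval, eval_sub, eval_mul, eval_C, eval_X]
    constructor
    · rintro ⟨h3, h4⟩
      rw [h3, mul_zero, sub_zero, mul_eq_zero, or_iff_right hn0] at h4
      exact ⟨h4, h3⟩
    · rintro ⟨h3, h4⟩
      simp [h3, h4]
  · exact (natDegree_derivative_le f).trans (Nat.sub_le_sub_right hf 1)
  · rw [natDegree_le_iff_coeff_eq_zero]
    intro N hN
    obtain ⟨k, rfl⟩ : ∃ k, N = k + 1 := ⟨N - 1, by omega⟩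
    rw [hcoeff]
    rcases (show m + 2 = k + 1 ∨ m + 2 < k + 1 by omega) with h | h
    · rw [h]
      push_cast
      ring
    · rw [coeff_eq_zero_of_natDegree_lt (hf.trans_lt h), mul_zero]

end Resultant

/-! ## Homogeneity -/

section Homogeneous

open MvPolynomial

variable {σ : Type*} {R : Type*} [CommRing R]

theorem isHomogeneous_det {m d : ℕ} {M : Matrix (Fin m) (Fin m) (MvPolynomial σ R)}
    (h : ∀ i j, (M i j).IsHomogeneous d) : M.det.IsHomogeneous (m * d) := by
  rw [det_apply]
  refine IsHomogeneous.sum _ _ _ fun s _ => ?_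
  have h1 : (∏ i, M (s i) i).IsHomogeneous (m * d) := by
    simpa using IsHomogeneous.prod Finset.univ (fun i => M (s i) i) (fun _ => d)
      fun i _ => h (s i) i
  rcases Int.units_eq_one_or (Equiv.Perm.sign s) with hs | hs
  · rw [hs, one_smul]
    exact h1
  · rw [hs, Units.neg_smul, one_smul]
    exact h1.neg

theorem coeff_mul_isHomogeneous {P Q : Polynomial (MvPolynomial σ R)} {d e : ℕ}
    (hP : ∀ k, (P.coeff k).IsHomogeneous d) (hQ : ∀ k, (Q.coeff k).IsHomogeneous e) (k : ℕ) :
    ((P * Q).coeff k).IsHomogeneous (d + e) := by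
  rw [Polynomial.coeff_mul]
  exact IsHomogeneous.sum _ _ _ fun x _ => (hP x.1).mul (hQ x.2)

theorem coeff_prod_isHomogeneous {ι : Type*} (s : Finset ι)
    {P : ι → Polynomial (MvPolynomial σ R)} (hP : ∀ i k, ((P i).coeff k).IsHomogeneous 1) (k : ℕ) :
    ((∏ i ∈ s, P i).coeff k).IsHomogeneous s.card := by
  induction s using Finset.cons_induction generalizing k with
  | empty =>
    rw [Finset.prod_empty, Polynomial.coeff_one, Finset.card_empty]
    split_ifs
    · exact isHomogeneous_one _ _
    · exact isHomogeneous_zero _ _ _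
  | cons i s hi ih =>
    rw [Finset.prod_cons, Finset.card_cons, add_comm]
    exact coeff_mul_isHomogeneous (hP i) ih k

theorem coeff_pencilPoly_isHomogeneous {n : ℕ} {A B : Matrix (Fin n) (Fin n) (MvPolynomial σ R)}
    (hA : ∀ i j, (A i j).IsHomogeneous 1) (hB : ∀ i j, (B i j).IsHomogeneous 1) (k : ℕ) :
    ((pencilPoly A B).coeff k).IsHomogeneous n := by
  rw [pencilPoly, det_apply, Polynomial.finsetSum_coeff]
  refine IsHomogeneous.sum _ _ _ fun s _ => ?_
  have h1 : ((∏ i, ((Polynomial.X : Polynomial (MvPolynomial σ R)) • A.map Polynomial.C +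
      B.map Polynomial.C) (s i) i).coeff k).IsHomogeneous n := by
    simpa using coeff_prod_isHomogeneous Finset.univ
      (P := fun i => ((Polynomial.X : Polynomial (MvPolynomial σ R)) • A.map Polynomial.C +
        B.map Polynomial.C) (s i) i) (fun i k => by
        simp only [Matrix.add_apply, Matrix.smul_apply, Matrix.map_apply, smul_eq_mul,
          Polynomial.coeff_add]
        refine IsHomogeneous.add ?_ ?_
        · cases k with
          | zero =>
            rw [Polynomial.coeff_X_mul_zero]
            exact isHomogeneous_zero _ _ _
          | succ k =>
            rw [Polynomial.coeff_X_mul, Polynomial.coeff_C]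
            split_ifs
            · exact hA _ _
            · exact isHomogeneous_zero _ _ _
        · rw [Polynomial.coeff_C]
          split_ifs
          · exact hB _ _
          · exact isHomogeneous_zero _ _ _) k
  rcases Int.units_eq_one_or (Equiv.Perm.sign s) with hs | hs
  · rw [hs, one_smul]
    exact h1
  · rw [hs, Units.neg_smul, one_smul, Polynomial.coeff_neg]
    exact h1.neg

theorem natCast_mul_isHomogeneous {P : MvPolynomial σ R} {d : ℕ} (h : P.IsHomogeneous d) (m : ℕ) :
    ((m : MvPolynomial σ R) * P).IsHomogeneous d := by
  rw [← map_natCast (C : R →+* MvPolynomial σ R)]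
  exact h.C_mul _

theorem formDiscr_isHomogeneous {n d : ℕ} {f : Polynomial (MvPolynomial σ R)}
    (hf : ∀ k, (f.coeff k).IsHomogeneous d) :
    (formDiscr n f).IsHomogeneous ((n - 1 + (n - 1)) * d) := by
  have h1 : ∀ k, ((Polynomial.derivative f).coeff k).IsHomogeneous d := by
    intro k
    rw [Polynomial.coeff_derivative, mul_comm]
    exact_mod_cast natCast_mul_isHomogeneous (hf (k + 1)) (k + 1)
  have h2 : ∀ k, ((Polynomial.C (n : MvPolynomial σ R) * f -
      Polynomial.X * Polynomial.derivative f).coeff k).IsHomogeneous d := by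
    intro k
    rw [Polynomial.coeff_sub, Polynomial.coeff_C_mul]
    refine (natCast_mul_isHomogeneous (hf k) n).sub ?_
    cases k with
    | zero =>
      rw [Polynomial.coeff_X_mul_zero]
      exact isHomogeneous_zero _ _ _
    | succ k =>
      rw [Polynomial.coeff_X_mul]
      exact h1 k
  refine isHomogeneous_det fun i j => ?_
  rw [Polynomial.sylvester, of_apply]
  induction j using Fin.addCases with
  | left j =>
    rw [Fin.addCases_left]
    split_ifs
    · exact h2 _
    · exact isHomogeneous_zero _ _ _
  | right j =>
    rw [Fin.addCases_right]
    split_ifs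
    · exact h1 _
    · exact isHomogeneous_zero _ _ _

/-- A factor of a homogeneous polynomial is homogeneous. -/
theorem exists_isHomogeneous_of_dvd [IsDomain R] {P Q : MvPolynomial σ R} {d : ℕ} (hQ : Q ≠ 0)
    (h : Q.IsHomogeneous d) (hPQ : P ∣ Q) : ∃ e, P.IsHomogeneous e := by
  obtain ⟨P', rfl⟩ := hPQ
  -- `φ` substitutes `X i ↦ X i * t`, so the coefficient of `t ^ k` is the homogeneous component of
  -- degree `k`, and homogeneity means that the image is a monomial in `t`. Degrees and trailing
  -- degrees both add up in products, so a factor of a monomial has only one term.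
  let φ : MvPolynomial σ R →ₐ[R] Polynomial (MvPolynomial σ R) :=
    aeval fun i => Polynomial.C (X i) * Polynomial.X
  have hmono : ∀ (s : σ →₀ ℕ) (r : R), φ (monomial s r) =
      Polynomial.C (monomial s r) * Polynomial.X ^ s.degree := by
    intro s r
    change aeval _ _ = _
    rw [aeval_monomial, monomial_eq, Polynomial.C_mul, Finsupp.prod, Finsupp.prod]
    simp only [mul_pow, Finset.prod_mul_distrib]
    rw [Finset.prod_pow_eq_pow_sum, map_prod]
    simp only [map_pow]
    rw [← mul_assoc]
    rfl
  have hcoeff : ∀ (F : MvPolynomial σ R) (k : ℕ), (φ F).coeff k = homogeneousComponent k F := by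
    intro F k
    induction F using MvPolynomial.induction_on' with
    | monomial s r =>
      rw [hmono, Polynomial.coeff_C_mul_X_pow]
      split_ifs with hk
      · rw [homogeneousComponent_eq_self]
        exact isHomogeneous_monomial r hk.symm
      · rw [homogeneousComponent_of_mem (isHomogeneous_monomial r rfl), if_neg hk]
    | add p q hp hq => rw [map_add, Polynomial.coeff_add, hp, hq, map_add]
  have hinj : ∀ F, φ F = 0 → F = 0 := by
    intro F hF
    rw [← sum_homogeneousComponent F]
    refine Finset.sum_eq_zero fun k _ => ?_
    rw [← hcoeff, hF, Polynomial.coeff_zero]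
  have hP0 : φ P ≠ 0 := fun h0 => hQ (by rw [hinj _ h0, zero_mul])
  have hP'0 : φ P' ≠ 0 := fun h0 => hQ (by rw [hinj _ h0, mul_zero])
  have hφQ : φ (P * P') = Polynomial.C (P * P') * Polynomial.X ^ d := by
    ext1 k
    rw [hcoeff, Polynomial.coeff_C_mul_X_pow, homogeneousComponent_of_mem h]
  rw [map_mul] at hφQ
  have h1 := Polynomial.natDegree_mul hP0 hP'0
  have h2 := Polynomial.natTrailingDegree_mul hP0 hP'0
  rw [hφQ, Polynomial.natDegree_C_mul_X_pow _ _ hQ] at h1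
  rw [hφQ, Polynomial.C_mul_X_pow_eq_monomial, Polynomial.natTrailingDegree_monomial hQ] at h2
  have h3 := Polynomial.natTrailingDegree_le_natDegree (φ P)
  have h4 := Polynomial.natTrailingDegree_le_natDegree (φ P')
  refine ⟨(φ P).natDegree, ?_⟩
  have h5 : homogeneousComponent (φ P).natDegree P = P := by
    refine Eq.trans (Eq.symm ?_) (sum_homogeneousComponent P)
    refine Finset.sum_eq_single _ (fun k _ hk => ?_) fun hk => ?_
    · rw [← hcoeff]
      rcases lt_or_gt_of_ne hk with hk | hk
      · exact Polynomial.coeff_eq_zero_of_lt_natTrailingDegree (by omega)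
      · exact Polynomial.coeff_eq_zero_of_natDegree_lt hk
    · refine homogeneousComponent_eq_zero _ _ ?_
      rw [Finset.mem_range] at hk
      omega
  have h6 := homogeneousComponent_isHomogeneous (φ P).natDegree P
  rwa [h5] at h6

end Homogeneous

/-! ## The hyperdeterminant -/

section Hyperdet

open MvPolynomial

/-- The discriminant of the determinant of the generic pencil. -/
noncomputable def hyperdet (n : ℕ) : MvPolynomial (TensorIdx n) ℂ :=
  formDiscr n (pencilPoly (slice X ![0, 1]) (slice X ![1, 0]))

variable {n : ℕ}

theorem hyperdet_isHomogeneous : (hyperdet n).IsHomogeneous ((n - 1 + (n - 1)) * n) := by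
  refine formDiscr_isHomogeneous (coeff_pencilPoly_isHomogeneous ?_ ?_)
  · intro i j
    simpa [slice_apply] using isHomogeneous_X ℂ _
  · intro i j
    simpa [slice_apply] using isHomogeneous_X ℂ _

theorem eval_hyperdet (T : TensorIdx n → ℂ) :
    eval T (hyperdet n) = formDiscr n (pencilPoly (slice T ![0, 1]) (slice T ![1, 0])) := by
  rw [hyperdet, formDiscr_map, pencilPoly_map, slice_map, slice_map]
  congr 2
  · ext j k
    simp [slice_apply]
  · ext j k
    simp [slice_apply]

/-- The root `t` of the dehomogenized form corresponds to the direction `(1, t)`, and infinity to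
`(0, 1)`; hence the case split on `a 0`. Kernel vectors are unaffected by rescaling the slice, so
they carry the vanishing of the coefficients from `a` to its normalization. -/
theorem eval_hyperdet_eq_zero_iff (hn : 2 ≤ n) (T : TensorIdx n → ℂ) :
    eval T (hyperdet n) = 0 ↔ IsTangent T := by
  rw [eval_hyperdet, formDiscr_eq_zero_iff hn (natDegree_pencilPoly_le _ _)]
  constructor
  · rintro (⟨h0, h1⟩ | ⟨t, h0, h1⟩)
    · refine isTangent_of_coeff (p := ![0, 1]) (q := ![1, 0]) (by simp) ?_ ?_
      · rw [coeff_pencilPoly_swap (slice T ![0, 1]) _ (by omega), Nat.sub_zero, h0]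
      · rw [coeff_pencilPoly_swap (slice T ![0, 1]) _ (by omega), h1]
    · exact isTangent_of_double_root (p := ![0, 1]) (q := ![1, 0]) (by simp) h0 h1
  · intro h
    obtain ⟨a, ha, hcoeff⟩ := h.exists_coeff
    by_cases h0 : a 0 = 0
    · left
      have h1 : a 1 ≠ 0 := by
        intro h1
        apply ha
        ext i
        fin_cases i
        · exact h0
        · exact h1
      have hN : slice T ![0, 1] = (a 1)⁻¹ • slice T a := by
        rw [← slice_smul_right]
        congr 1
        ext i
        fin_cases i
        · simp [h0]
        · simp [h1]
      obtain ⟨b, c, hb, hc, hNc, hbN, hbc⟩ := coeff_pencilPoly_eq_zero_iff.1 (hcoeff ![1, 0])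
      obtain ⟨h2, h3⟩ := coeff_pencilPoly_eq_zero_iff (A := slice T ![1, 0])
        (N := slice T ![0, 1]).2 ⟨b, c, hb, hc, by rw [hN, smul_mulVec, hNc, smul_zero],
          by rw [hN, vecMul_smul, hbN, smul_zero], hbc⟩
      rw [coeff_pencilPoly_swap (slice T ![0, 1]) _ (by omega)] at h2 h3
      exact ⟨h2, h3⟩
    · right
      have hN : (a 1 / a 0) • slice T ![0, 1] + slice T ![1, 0] = (a 0)⁻¹ • slice T a := by
        ext j k
        simp only [slice_apply, Matrix.add_apply, Matrix.smul_apply, smul_eq_mul, cons_val_zero,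
          cons_val_one]
        field_simp
        ring
      obtain ⟨b, c, hb, hc, hNc, hbN, hbc⟩ := coeff_pencilPoly_eq_zero_iff.1 (hcoeff ![0, 1])
      obtain ⟨h2, h3⟩ := coeff_pencilPoly_eq_zero_iff (A := slice T ![0, 1])
        (N := (a 1 / a 0) • slice T ![0, 1] + slice T ![1, 0]).2
        ⟨b, c, hb, hc, by rw [hN, smul_mulVec, hNc, smul_zero],
          by rw [hN, vecMul_smul, hbN, smul_zero], hbc⟩
      rw [← taylor_pencilPoly] at h2 h3
      rw [Polynomial.taylor_coeff_zero] at h2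
      rw [Polynomial.taylor_coeff_one] at h3
      exact ⟨_, h2, h3⟩

/-- The pencil spanned by the identity and a diagonal matrix with distinct entries is not
tangent. -/
theorem hyperdet_ne_zero (hn : 2 ≤ n) : hyperdet n ≠ 0 := by
  intro h0
  let T : TensorIdx n → ℂ := fun x => if x.2.1 = x.2.2 then ![1, (x.2.1 : ℂ)] x.1 else 0
  have hT : ∀ a, slice T a = diagonal fun j : Fin n => a 0 + a 1 * ((j : ℕ) : ℂ) := by
    intro a
    ext j k
    rw [slice_apply, diagonal_apply]
    by_cases hjk : j = k
    · simp [T, hjk]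
    · simp [T, hjk]
  have h1 : IsTangent T := (eval_hyperdet_eq_zero_iff hn T).1 (by rw [h0, map_zero])
  obtain ⟨a, b, c, ha, hb, hc, hNc, hbN, hbc⟩ := h1
  rw [hT] at hNc hbN
  obtain ⟨j, hj⟩ := Function.ne_iff.1 hc
  have hc' : ∀ k : Fin n, (a 0 + a 1 * ((k : ℕ) : ℂ)) * c k = 0 := fun k => by
    simpa [mulVec_diagonal] using congrFun hNc k
  have hb' : ∀ k : Fin n, b k * (a 0 + a 1 * ((k : ℕ) : ℂ)) = 0 := fun k => by
    simpa [vecMul_diagonal] using congrFun hbN k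
  have hj0 : a 0 + a 1 * ((j : ℕ) : ℂ) = 0 := (mul_eq_zero.1 (hc' j)).resolve_right hj
  -- Only one diagonal entry can vanish, so `b` and `c` have the same single support `j`; pairing
  -- them through the identity slice then gives `b j * c j = 0`.
  have hk0 : ∀ k, k ≠ j → a 0 + a 1 * ((k : ℕ) : ℂ) ≠ 0 := by
    intro k hk hk0
    have h2 : a 1 * (((k : ℕ) : ℂ) - ((j : ℕ) : ℂ)) = 0 := by linear_combination hk0 - hj0
    have h3 : a 1 = 0 := by
      refine (mul_eq_zero.1 h2).resolve_right fun h4 => hk ?_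
      exact Fin.ext (by exact_mod_cast sub_eq_zero.1 h4)
    apply ha
    ext i
    fin_cases i
    · simpa [h3] using hj0
    · exact h3
  have hbk : ∀ k, k ≠ j → b k = 0 := fun k hk => (mul_eq_zero.1 (hb' k)).resolve_right (hk0 k hk)
  have h2 := hbc ![1, 0]
  rw [hT, dotProduct, Finset.sum_eq_single j (fun k _ hk => by rw [hbk k hk, zero_mul])
    (by simp), mulVec_diagonal] at h2
  apply hb
  ext k
  by_cases hk : k = j
  · subst hk
    simpa [show c k ≠ 0 from hj] using h2
  · exact hbk k hk

end Hyperdet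

/-! ## The dual variety -/

section Dual

variable {n : ℕ}

theorem sum_mul_pureTensor {K : Type*} [Field K] (T : TensorIdx n → K) (a : Fin 2 → K)
    (b c : Fin n → K) : ∑ x, T x * pureTensor a b c x = b ⬝ᵥ slice T a *ᵥ c := by
  rw [Fintype.sum_prod_type, Fin.sum_univ_two, Fintype.sum_prod_type, Fintype.sum_prod_type,
    ← Finset.sum_add_distrib]
  simp only [dotProduct, mulVec, Finset.mul_sum]
  refine Finset.sum_congr rfl fun j _ => ?_
  rw [← Finset.sum_add_distrib]
  refine Finset.sum_congr rfl fun k _ => ?_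
  simp only [pureTensor, slice_apply]
  ring

theorem slice_right_zero {K : Type*} [Field K] (T : TensorIdx n → K) : slice T 0 = 0 := by
  ext j k
  simp [slice_apply]

/-- Varying one factor of `a ⊗ b ⊗ c` at a time separates tangency into the three kernel conditions.
-/
theorem isTangent_iff (T : TensorIdx n → ℂ) :
    (∃ (a : Fin 2 → ℂ) (b c : Fin n → ℂ), pureTensor a b c ≠ 0 ∧
      ∀ v ∈ segreTangentSpace a b c, ∑ x, T x * v x = 0) ↔ IsTangent T := by
  have hpure : ∀ (a : Fin 2 → ℂ) (b c : Fin n → ℂ),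
      pureTensor a b c ≠ 0 ↔ a ≠ 0 ∧ b ≠ 0 ∧ c ≠ 0 := by
    intro a b c
    constructor
    · intro h
      refine ⟨?_, ?_, ?_⟩ <;>
      · rintro rfl
        exact h (by ext x; simp [pureTensor])
    · rintro ⟨ha, hb, hc⟩ h
      obtain ⟨i, hi⟩ := Function.ne_iff.1 ha
      obtain ⟨j, hj⟩ := Function.ne_iff.1 hb
      obtain ⟨k, hk⟩ := Function.ne_iff.1 hc
      exact mul_ne_zero (mul_ne_zero hi hj) hk (congrFun h (i, j, k))
  constructor
  · rintro ⟨a, b, c, hne, h⟩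
    obtain ⟨ha, hb, hc⟩ := (hpure a b c).1 hne
    have h' : ∀ (a' : Fin 2 → ℂ) (b' c' : Fin n → ℂ), b ⬝ᵥ slice T a' *ᵥ c +
        b' ⬝ᵥ slice T a *ᵥ c + b ⬝ᵥ slice T a *ᵥ c' = 0 := by
      intro a' b' c'
      rw [← sum_mul_pureTensor, ← sum_mul_pureTensor, ← sum_mul_pureTensor,
        ← Finset.sum_add_distrib, ← Finset.sum_add_distrib, ← h _ ⟨a', b', c', rfl⟩]
      refine Finset.sum_congr rfl fun x _ => ?_
      simp only [Pi.add_apply]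
      ring
    refine ⟨a, b, c, ha, hb, hc, ?_, ?_, fun a' => ?_⟩
    · refine dotProduct_eq_zero _ fun w => ?_
      rw [dotProduct_comm]
      simpa [slice_right_zero] using h' 0 w 0
    · refine dotProduct_eq_zero _ fun w => ?_
      rw [← dotProduct_mulVec]
      simpa [slice_right_zero] using h' 0 0 w
    · simpa using h' a' 0 0
  · rintro ⟨a, b, c, ha, hb, hc, hNc, hbN, hbc⟩
    refine ⟨a, b, c, (hpure a b c).2 ⟨ha, hb, hc⟩, ?_⟩
    rintro v ⟨a', b', c', rfl⟩
    simp only [Pi.add_apply, mul_add, Finset.sum_add_distrib, sum_mul_pureTensor]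
    rw [hbc, hNc, dotProduct_mulVec b _ c', hbN]
    simp

/-- The set of tangent hyperplanes is already the zero set of a form, so taking the closure adds
nothing. -/
theorem segreDual_eq_projZeros (hn : 2 ≤ n) : segreDual n = projZeros (hyperdet n) := by
  have h : {T : ℙ ℂ (TensorIdx n → ℂ) | ∃ (a : Fin 2 → ℂ) (b c : Fin n → ℂ),
      pureTensor a b c ≠ 0 ∧ ∀ v ∈ segreTangentSpace a b c, ∑ x, T.rep x * v x = 0} =
      projZeros (hyperdet n) := by
    ext p
    exact (isTangent_iff p.rep).trans (eval_hyperdet_eq_zero_iff hn p.rep).symm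
  rw [segreDual, h]
  refine Set.Subset.antisymm (fun p hp => hp _ _ hyperdet_isHomogeneous subset_rfl) ?_
  exact fun p hp F d _ hF => hF hp

theorem mem_segreDual_iff (hn : 2 ≤ n) (p : ℙ ℂ (TensorIdx n → ℂ)) :
    p ∈ segreDual n ↔ IsTangent p.rep := by
  rw [segreDual_eq_projZeros hn]
  exact eval_hyperdet_eq_zero_iff hn p.rep

theorem eval_smul_of_isHomogeneous {ι R : Type*} [CommRing R] {F : MvPolynomial ι R} {d : ℕ}
    (hF : F.IsHomogeneous d) (c : R) (v : ι → R) :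
    MvPolynomial.eval (c • v) F = c ^ d * MvPolynomial.eval v F := by
  rw [MvPolynomial.eval_eq, MvPolynomial.eval_eq, Finset.mul_sum]
  refine Finset.sum_congr rfl fun s hs => ?_
  simp only [Pi.smul_apply, smul_eq_mul, mul_pow, Finset.prod_mul_distrib]
  rw [Finset.prod_pow_eq_pow_sum, ← hF.degree_eq_sum_deg_support hs]
  ring

theorem mk_mem_projZeros_iff {ι : Type*} {F : MvPolynomial ι ℂ} {d : ℕ} (hF : F.IsHomogeneous d)
    {v : ι → ℂ} (hv : v ≠ 0) :
    Projectivization.mk ℂ v hv ∈ projZeros F ↔ MvPolynomial.eval v F = 0 := by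
  obtain ⟨a, ha⟩ := Projectivization.exists_smul_eq_mk_rep ℂ v hv
  change MvPolynomial.eval _ F = 0 ↔ _
  rw [← ha]
  change MvPolynomial.eval ((a : ℂ) • v) F = 0 ↔ _
  rw [eval_smul_of_isHomogeneous hF, mul_eq_zero, or_iff_right (pow_ne_zero d a.ne_zero)]

/-! ## The generic rank -/

theorem isGenericRank_segre (hn : 2 ≤ n) : IsGenericRank (segre ℂ n) n := by
  refine ⟨hyperdet n, _, hyperdet_isHomogeneous, hyperdet_ne_zero hn, fun f hf => ?_⟩
  have h1 : ¬ IsTangent f.rep := fun h => hf ((eval_hyperdet_eq_zero_iff hn f.rep).2 h)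
  obtain ⟨h2, a, ha⟩ := hasDecomp_of_not_isTangent h1
  rw [← xRank_eq f.rep_nonzero h2 ha, Projectivization.mk_rep]

theorem IsGenericRank.unique {ι : Type*} [Nonempty ι] {X : Set (ℙ ℂ (ι → ℂ))} {g g' : ℕ}
    (h : IsGenericRank X g) (h' : IsGenericRank X g') : g = g' := by
  obtain ⟨F, d, hF, hF0, hFX⟩ := h
  obtain ⟨F', d', hF', hF'0, hF'X⟩ := h'
  obtain ⟨i⟩ := ‹Nonempty ι›
  -- The factor `X i` forces the common nonvanishing point to be a nonzero vector, that is, a point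
  -- of projective space.
  have h0 : F * F' * MvPolynomial.X i ≠ 0 :=
    mul_ne_zero (mul_ne_zero hF0 hF'0) (MvPolynomial.X_ne_zero i)
  have h1 : ∃ v, MvPolynomial.eval v (F * F' * MvPolynomial.X i) ≠ 0 := by
    by_contra hcon
    push Not at hcon
    exact h0 (MvPolynomial.funext fun v => by rw [hcon, map_zero])
  obtain ⟨v, hv⟩ := h1
  rw [map_mul, map_mul, MvPolynomial.eval_X] at hv
  have hv0 : v ≠ 0 := by
    rintro rfl
    exact hv (by simp)
  have h2 := hFX (Projectivization.mk ℂ v hv0)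
    fun hm => left_ne_zero_of_mul (left_ne_zero_of_mul hv) ((mk_mem_projZeros_iff hF hv0).1 hm)
  have h3 := hF'X (Projectivization.mk ℂ v hv0)
    fun hm => right_ne_zero_of_mul (left_ne_zero_of_mul hv) ((mk_mem_projZeros_iff hF' hv0).1 hm)
  exact_mod_cast h2.symm.trans h3

theorem genericRankLocus_segre (hn : 2 ≤ n) :
    genericRankLocus (segre ℝ n) (segre ℂ n) = {f | xRank (segre ℝ n) f = n} := by
  have : Nonempty (TensorIdx n) := ⟨(0, ⟨0, by omega⟩, ⟨0, by omega⟩)⟩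
  ext f
  constructor
  · rintro ⟨g, hg, hf⟩
    rwa [IsGenericRank.unique hg (isGenericRank_segre hn)] at hf
  · intro hf
    exact ⟨n, isGenericRank_segre hn, hf⟩

end Dual

/-! ## Pencils with sign changes -/

section SignChanges

variable {n : ℕ}

/-- The determinant of the pencil of `T` along the line `t ↦ t p + q` changes sign between any two
consecutive points `μ i`. -/
def SignChanges (p q : Fin 2 → ℝ) (μ : Fin (n + 1) → ℝ) (T : TensorIdx n → ℝ) : Prop :=
  ∀ i : Fin n, (μ i.castSucc • slice T p + slice T q).det *
    (μ i.succ • slice T p + slice T q).det < 0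

theorem continuous_slice {R : Type*} [CommRing R] [TopologicalSpace R] [IsTopologicalRing R]
    (a : Fin 2 → R) : Continuous fun T : TensorIdx n → R => slice T a := by
  refine continuous_matrix fun j k => ?_
  simp only [slice_apply]
  fun_prop

theorem continuous_det_pencil (p q : Fin 2 → ℝ) (t : ℝ) :
    Continuous fun T : TensorIdx n → ℝ => (t • slice T p + slice T q).det :=
  (((continuous_slice p).const_smul t).add (continuous_slice q)).matrix_det

theorem isOpen_signChanges (p q : Fin 2 → ℝ) (μ : Fin (n + 1) → ℝ) :
    IsOpen {T | SignChanges p q μ T} := by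
  simp only [SignChanges, Set.ofPred_forall]
  exact isOpen_iInter_of_finite fun i => isOpen_lt
    ((continuous_det_pencil p q _).mul (continuous_det_pencil p q _)) continuous_const

theorem det_pencil_smul {R : Type*} [CommRing R] (c t : R) (T : TensorIdx n → R)
    (p q : Fin 2 → R) :
    (t • slice (c • T) p + slice (c • T) q).det = c ^ n * (t • slice T p + slice T q).det := by
  rw [slice_smul, slice_smul, smul_comm, ← smul_add, det_smul, Fintype.card_fin]

theorem scaleInvariant_signChanges (p q : Fin 2 → ℝ) (μ : Fin (n + 1) → ℝ) :
    ScaleInvariant (SignChanges p q μ) := by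
  intro c T hc
  refine forall_congr' fun i => ?_
  rw [det_pencil_smul, det_pencil_smul, mul_mul_mul_comm]
  have : 0 < c ^ n * c ^ n := mul_self_pos.2 (pow_ne_zero n hc)
  constructor
  · intro h
    by_contra h'
    exact absurd h (not_lt.2 (mul_nonneg this.le (not_lt.1 h')))
  · intro h
    exact mul_neg_of_pos_of_neg this h

/-- The intermediate value theorem puts one root in each of the `n` disjoint intervals, so the roots
are distinct. -/
theorem SignChanges.hasDecomp {p q : Fin 2 → ℝ} {μ : Fin (n + 1) → ℝ} {T : TensorIdx n → ℝ}
    (h : SignChanges p q μ T) (hn : 0 < n) (hpq : p 0 * q 1 - p 1 * q 0 ≠ 0)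
    (hμ : StrictMono μ) : HasDecomp n T ∧ ∃ a, (slice T a).det ≠ 0 := by
  have hreg : (slice T (μ (Fin.castSucc ⟨0, hn⟩) • p + (1 : ℝ) • q)).det ≠ 0 := by
    rw [slice_comb, one_smul]
    exact left_ne_zero_of_mul (h ⟨0, hn⟩).ne
  have hroot : ∀ i : Fin n, ∃ t, μ i.castSucc < t ∧ t < μ i.succ ∧
      (t • slice T p + slice T q).det = 0 := by
    intro i
    have hcont : ContinuousOn (fun t : ℝ => (t • slice T p + slice T q).det)
        (Set.Icc (μ i.castSucc) (μ i.succ)) := by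
      simp only [← eval_pencilPoly]
      exact (pencilPoly _ _).continuous.continuousOn
    have hle : μ i.castSucc ≤ μ i.succ := (hμ Fin.castSucc_lt_succ).le
    rcases mul_neg_iff.1 (h i) with ⟨h1, h2⟩ | ⟨h1, h2⟩
    · obtain ⟨t, ⟨ht1, ht2⟩, ht⟩ := intermediate_value_Ioo' hle hcont ⟨h2, h1⟩
      exact ⟨t, ht1, ht2, ht⟩
    · obtain ⟨t, ⟨ht1, ht2⟩, ht⟩ := intermediate_value_Ioo hle hcont ⟨h1, h2⟩
      exact ⟨t, ht1, ht2, ht⟩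
  choose l hl1 hl2 hl using hroot
  have hlmono : StrictMono l := by
    intro i j hij
    have h1 : μ i.succ ≤ μ j.castSucc := hμ.monotone (by
      rw [Fin.le_def, Fin.val_succ, Fin.val_castSucc]
      exact hij)
    exact (hl2 i).trans_le (h1.trans (hl1 j).le)
  exact ⟨hasDecomp_of_roots hpq hreg hlmono.injective hl, _, hreg⟩

/-- Points interlacing a strictly increasing finite sequence. -/
theorem exists_interlacing (hn : 0 < n) {l : Fin n → ℝ} (hl : StrictMono l) :
    ∃ μ : Fin (n + 1) → ℝ, StrictMono μ ∧ ∀ i, μ i.castSucc < l i ∧ l i < μ i.succ := by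
  obtain ⟨m, rfl⟩ : ∃ m, n = m + 1 := ⟨n - 1, by omega⟩
  -- The point chosen for `i` lies beyond `l i` and before the next term, if there is one; a single
  -- extra point below `l 0` is prepended later.
  have h : ∀ i : Fin (m + 1), ∃ x, l i < x ∧ ∀ j : Fin m, i = j.castSucc → x < l j.succ := by
    intro i
    induction i using Fin.lastCases with
    | last => exact ⟨l (Fin.last m) + 1, by linarith,
        fun j hj => absurd hj (Fin.castSucc_lt_last j).ne'⟩
    | cast j =>
      obtain ⟨x, hx1, hx2⟩ := exists_between (hl (Fin.castSucc_lt_succ (i := j)))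
      refine ⟨x, hx1, fun j' hj' => ?_⟩
      rw [← Fin.castSucc_injective _ hj']
      exact hx2
  choose r hr1 hr2 using h
  let μ : Fin (m + 2) → ℝ := Fin.cons (l 0 - 1) r
  have hμ : ∀ i : Fin (m + 1), μ i.castSucc < l i ∧ l i < μ i.succ := by
    intro i
    refine ⟨?_, by simpa [μ] using hr1 i⟩
    induction i using Fin.cases with
    | zero => simp [μ]
    | succ j =>
      rw [← Fin.succ_castSucc]
      simpa [μ] using hr2 _ j rfl
  exact ⟨μ, Fin.strictMono_iff_lt_succ.2 fun i => (hμ i).1.trans (hμ i).2, hμ⟩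

/-- A real pencil with `n` distinct real roots changes sign at interlacing points. -/
theorem exists_signChanges (hn : 0 < n) {T : TensorIdx n → ℝ} {p q : Fin 2 → ℝ}
    (hp : (slice T p).det ≠ 0) {l : Fin n → ℝ} (hl : Function.Injective l)
    (hroot : ∀ i, (l i • slice T p + slice T q).det = 0) :
    ∃ μ : Fin (n + 1) → ℝ, StrictMono μ ∧ SignChanges p q μ T := by
  wlog hmono : StrictMono l generalizing l
  · exact this (l := l ∘ Tuple.sort l) (hl.comp (Equiv.injective _)) (fun i => hroot _)
      ((Tuple.monotone_sort l).strictMono_of_injective (hl.comp (Equiv.injective _)))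
  obtain ⟨μ, hμ, hμl⟩ := exists_interlacing hn hmono
  refine ⟨μ, hμ, ?_⟩
  have hfac : ∀ t : ℝ, (t • slice T p + slice T q).det = (slice T p).det * ∏ i, (t - l i) := by
    intro t
    have hcoeff : (pencilPoly (slice T p) (slice T q)).coeff n = (slice T p).det :=
      coeff_pencilPoly_card _ _
    have hdeg : (pencilPoly (slice T p) (slice T q)).natDegree = n :=
      le_antisymm (natDegree_pencilPoly_le _ _)
        (Polynomial.le_natDegree_of_ne_zero (by rw [hcoeff]; exact hp))
    have hne : pencilPoly (slice T p) (slice T q) ≠ 0 := by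
      intro h0
      rw [h0, Polynomial.coeff_zero] at hcoeff
      exact hp hcoeff.symm
    have hmonic : (∏ i, (Polynomial.X - Polynomial.C (l i))).Monic :=
      Polynomial.monic_prod_of_monic _ _ fun i _ => Polynomial.monic_X_sub_C _
    have hdeg' : (∏ i, (Polynomial.X - Polynomial.C (l i))).natDegree = n := by
      rw [Polynomial.natDegree_prod_of_monic _ _ fun i _ => Polynomial.monic_X_sub_C _]
      simp
    have hpoly : pencilPoly (slice T p) (slice T q) =
        Polynomial.C (slice T p).det * ∏ i, (Polynomial.X - Polynomial.C (l i)) := by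
      refine Polynomial.eq_of_degree_le_of_eval_index_eq (s := Finset.univ) (v := l)
        hl.injOn ?_ ?_ ?_ ?_
      · rw [Finset.card_univ, Fintype.card_fin, Polynomial.degree_eq_natDegree hne, hdeg]
      · rw [Polynomial.degree_C_mul hp, Polynomial.degree_eq_natDegree hne,
          Polynomial.degree_eq_natDegree hmonic.ne_zero, hdeg, hdeg']
      · rw [Polynomial.leadingCoeff, hdeg, hcoeff, Polynomial.leadingCoeff_mul,
          Polynomial.leadingCoeff_C, hmonic.leadingCoeff, mul_one]
      · intro i _
        rw [eval_pencilPoly, hroot, Polynomial.eval_mul, Polynomial.eval_prod,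
          Finset.prod_eq_zero (Finset.mem_univ i) (by simp), mul_zero]
    rw [← eval_pencilPoly, hpoly]
    simp [Polynomial.eval_prod]
  intro i
  -- Between consecutive interlacing points only the factor of the root `l i` changes sign; all the
  -- others keep theirs.
  rw [hfac, hfac, mul_mul_mul_comm, ← Finset.prod_mul_distrib]
  refine mul_neg_of_pos_of_neg (mul_self_pos.2 hp) ?_
  rw [← Finset.mul_prod_erase _ _ (Finset.mem_univ i)]
  refine mul_neg_of_neg_of_pos ?_ (Finset.prod_pos fun k hk => ?_)
  · exact mul_neg_of_neg_of_pos (by linarith [(hμl i).1]) (by linarith [(hμl i).2])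
  · rcases lt_or_gt_of_ne (Finset.ne_of_mem_erase hk) with hki | hki
    · have h1 : μ k.succ ≤ μ i.castSucc := hμ.monotone (by
        rw [Fin.le_def, Fin.val_succ, Fin.val_castSucc]
        exact hki)
      have h2 := hμ (Fin.castSucc_lt_succ (i := i))
      have h3 := (hμl k).2
      exact mul_pos (by linarith) (by linarith)
    · have h1 : μ i.succ ≤ μ k.castSucc := hμ.monotone (by
        rw [Fin.le_def, Fin.val_succ, Fin.val_castSucc]
        exact hki)
      have h2 := hμ (Fin.castSucc_lt_succ (i := i))
      have h3 := (hμl k).1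
      exact mul_pos_of_neg_of_neg (by linarith) (by linarith)

end SignChanges

/-! ## A closed condition satisfied by sums of `n` real decomposable tensors -/

section Bound

variable {n : ℕ}

/-- A real linear form at a nonreal point is bounded below by its values at real points. -/
theorem abs_im_mul_le (z : ℂ) (t x y : ℝ) :
    |z.im| * |t * x + y| ≤ ‖(t : ℂ) - z‖ * ‖z * x + y‖ := by
  -- Multiplying by `t - z̄` makes the imaginary part proportional to the value of the linear form
  -- at `t`.
  have h1 : (((t : ℂ) - starRingEnd ℂ z) * (z * x + y)).im = z.im * (t * x + y) := by
    simp
    ring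
  have h2 : ‖(t : ℂ) - starRingEnd ℂ z‖ = ‖(t : ℂ) - z‖ := by
    rw [← Complex.norm_conj ((t : ℂ) - z), map_sub, Complex.conj_ofReal]
  rw [← abs_mul, ← h1, ← h2, ← norm_mul]
  exact Complex.abs_im_le_norm _

theorem complexifyVec_apply {ι : Type*} (T : ι → ℝ) (x : ι) : complexifyVec ι T x = (T x : ℂ) :=
  rfl

theorem map_slice_complexify (T : TensorIdx n → ℝ) (a : Fin 2 → ℝ) :
    (slice T a).map Complex.ofRealHom =
      slice (complexifyVec _ T) (fun i => (a i : ℂ)) :=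
  slice_map Complex.ofRealHom T a

theorem complexifyVec_sum_pureTensor {m : ℕ} (α : Fin m → Fin 2 → ℝ) (β γ : Fin m → Fin n → ℝ) :
    complexifyVec _ (∑ i, pureTensor (α i) (β i) (γ i)) =
      ∑ i, pureTensor (fun j => (α i j : ℂ)) (fun j => (β i j : ℂ)) (fun j => (γ i j : ℂ)) := by
  rw [map_sum]
  refine Finset.sum_congr rfl fun i _ => ?_
  ext x
  simp [complexifyVec_apply, pureTensor]

/-- The value at `z` of the complexified determinant of the pencil of `T` along `t ↦ t p + q`. -/
noncomputable def complexDet (T : TensorIdx n → ℝ) (p q : Fin 2 → ℝ) (z : ℂ) : ℂ :=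
  ((pencilPoly (slice T p) (slice T q)).map Complex.ofRealHom).eval z

theorem complexDet_eq (T : TensorIdx n → ℝ) (p q : Fin 2 → ℝ) (z : ℂ) :
    complexDet T p q z = (z • slice (complexifyVec _ T) (fun i => (p i : ℂ)) +
      slice (complexifyVec _ T) (fun i => (q i : ℂ))).det := by
  rw [complexDet, pencilPoly_map, eval_pencilPoly, map_slice_complexify, map_slice_complexify]

theorem complexDet_ofReal (T : TensorIdx n → ℝ) (p q : Fin 2 → ℝ) (t : ℝ) :
    complexDet T p q t = ((t • slice T p + slice T q).det : ℝ) := by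
  rw [complexDet, ← eval_pencilPoly]
  exact Polynomial.eval_map_apply Complex.ofRealHom t

/-- The determinant of the pencil is a constant times `n` real linear forms, and the bound holds
factor by factor. It is a closed condition on `T`, and a nonreal root `z` would force the
determinant to vanish at every real `t`. -/
theorem HasDecomp.abs_im_pow_mul_le {T : TensorIdx n → ℝ} (h : HasDecomp n T) (p q : Fin 2 → ℝ)
    (z : ℂ) (t : ℝ) :
    |z.im| ^ n * ‖complexDet T p q t‖ ≤ ‖(t : ℂ) - z‖ ^ n * ‖complexDet T p q z‖ := by
  obtain ⟨α, β, γ, rfl⟩ := h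
  obtain ⟨c, key⟩ : ∃ c : ℂ, ∀ z : ℂ, complexDet (∑ i, pureTensor (α i) (β i) (γ i)) p q z =
      c * ∏ i, (z * ((α i 0 * p 0 + α i 1 * p 1 : ℝ) : ℂ) +
        ((α i 0 * q 0 + α i 1 * q 1 : ℝ) : ℂ)) := by
    refine ⟨(Matrix.of fun i j => (β i j : ℂ)).det * (Matrix.of fun i j => (γ i j : ℂ)).det,
      fun z => ?_⟩
    have h1 := slice_comb (complexifyVec _ (∑ i, pureTensor (α i) (β i) (γ i))) z 1
      (fun i => (p i : ℂ)) (fun i => (q i : ℂ))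
    rw [one_smul, one_smul] at h1
    rw [complexDet_eq, ← h1, complexifyVec_sum_pureTensor, slice_sum_pureTensor, det_mul, det_mul,
      det_transpose, det_diagonal, mul_right_comm]
    congr 1
    refine Finset.prod_congr rfl fun i _ => ?_
    simp only [Pi.add_apply, Pi.smul_apply, smul_eq_mul]
    push_cast
    ring
  rw [key, key, norm_mul, norm_mul, mul_left_comm, mul_left_comm (‖(t : ℂ) - z‖ ^ n)]
  refine mul_le_mul_of_nonneg_left ?_ (norm_nonneg _)
  rw [norm_prod, norm_prod]
  have h1 : ∀ c : ℝ, c ^ n = ∏ _i : Fin n, c := fun c => by simp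
  rw [h1, h1, ← Finset.prod_mul_distrib, ← Finset.prod_mul_distrib]
  refine Finset.prod_le_prod (fun i _ => by positivity) fun i _ => ?_
  have h2 := abs_im_mul_le z t (α i 0 * p 0 + α i 1 * p 1) (α i 0 * q 0 + α i 1 * q 1)
  rw [← Real.norm_eq_abs (t * _ + _), ← Complex.norm_real] at h2
  simpa only [Complex.ofReal_add, Complex.ofReal_mul] using h2

theorem continuous_complexDet (p q : Fin 2 → ℝ) (z : ℂ) :
    Continuous fun T : TensorIdx n → ℝ => complexDet T p q z := by
  simp only [complexDet_eq]
  have h1 : Continuous fun T : TensorIdx n → ℝ => complexifyVec (TensorIdx n) T :=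
    continuous_pi fun x => Complex.continuous_ofReal.comp (continuous_apply x)
  have h2 : ∀ a : Fin 2 → ℂ, Continuous fun T : TensorIdx n → ℝ => slice (complexifyVec _ T) a :=
    fun a => (continuous_slice a).comp h1
  exact (((h2 _).const_smul z).add (h2 _)).matrix_det

theorem complexDet_smul (c : ℝ) (T : TensorIdx n → ℝ) (p q : Fin 2 → ℝ) (z : ℂ) :
    complexDet (c • T) p q z = (c : ℂ) ^ n * complexDet T p q z := by
  have h : complexifyVec _ (c • T) = (c : ℂ) • complexifyVec _ T := by
    ext x
    simp [complexifyVec_apply]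
  rw [complexDet_eq, complexDet_eq, h]
  exact det_pencil_smul (c : ℂ) z (complexifyVec _ T) _ _

end Bound

/-! ## The boundary of the locus of real tensors of rank `n` -/

section Boundary

variable {n : ℕ}

theorem mem_interior_of_open {ι : Type*} {R : Set (ℙ ℝ (ι → ℝ))} {P : (ι → ℝ) → Prop}
    (hP : ScaleInvariant P) (hopen : IsOpen {v | P v})
    (h : ∀ v (hv : v ≠ 0), P v → Projectivization.mk ℝ v hv ∈ R) {f : ℙ ℝ (ι → ℝ)}
    (hf : P f.rep) : f ∈ interior R := by
  refine mem_interior.2 ⟨_, fun g hg => ?_, hP.isOpen hopen, hf⟩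
  rw [← g.mk_rep]
  exact h _ _ hg

/-- A limit of real tensors of rank `n` whose complexification is not tangent is an interior point
of the locus of real tensors of rank `n`. -/
theorem mem_interior_of_mem_closure (hn : 0 < n) {f : ℙ ℝ (TensorIdx n → ℝ)}
    (hf : f ∈ closure {f | xRank (segre ℝ n) f = n})
    (ht : ¬ IsTangent (complexifyVec _ f.rep)) : f ∈ interior {f | xRank (segre ℝ n) f = n} := by
  -- Failure of the bound is open and scale invariant, so it would be shared by a nearby tensor of
  -- rank `n`.
  have hbound : ∀ (p q : Fin 2 → ℝ) (z : ℂ) (t : ℝ), |z.im| ^ n * ‖complexDet f.rep p q t‖ ≤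
      ‖(t : ℂ) - z‖ ^ n * ‖complexDet f.rep p q z‖ := by
    intro p q z t
    by_contra hlt
    let P : (TensorIdx n → ℝ) → Prop := fun T =>
      ‖(t : ℂ) - z‖ ^ n * ‖complexDet T p q z‖ < |z.im| ^ n * ‖complexDet T p q t‖
    have hP : ScaleInvariant P := by
      intro c T hc
      have hc' : 0 < ‖(c : ℂ) ^ n‖ := norm_pos_iff.2 (pow_ne_zero n (by exact_mod_cast hc))
      simp only [P]
      rw [complexDet_smul, complexDet_smul, norm_mul, norm_mul, mul_left_comm,
        mul_left_comm (|z.im| ^ n), mul_lt_mul_iff_of_pos_left hc']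
    have hopen : IsOpen {T | P T} :=
      isOpen_lt ((continuous_complexDet p q z).norm.const_mul _)
        ((continuous_complexDet p q t).norm.const_mul _)
    obtain ⟨g, hg1, hg2⟩ := mem_closure_iff.1 hf _ (hP.isOpen hopen) (not_le.1 hlt)
    have hg3 : xRank (segre ℝ n) (Projectivization.mk ℝ g.rep g.rep_nonzero) = n := by
      rw [g.mk_rep]
      exact hg2
    exact not_lt.2 ((hasDecomp_of_xRank_eq _ hg3).abs_im_pow_mul_le p q z t) hg1
  set T := f.rep with hT
  have hreg : pencilPoly (slice T ![0, 1]) (slice T ![1, 0]) ≠ 0 := by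
    intro h0
    refine pencilPoly_ne_zero_of_not_isTangent ht ?_
    have h1 := congrArg (Polynomial.map Complex.ofRealHom) h0
    rw [pencilPoly_map, map_slice_complexify, map_slice_complexify, Polynomial.map_zero] at h1
    rw [← h1]
    congr 2 <;> ext i <;> fin_cases i <;> simp
  obtain ⟨s, hs⟩ := exists_det_slice_ne_zero hreg
  have hpq : (![1, s] : Fin 2 → ℝ) 0 * (![0, 1] : Fin 2 → ℝ) 1 -
      (![1, s] : Fin 2 → ℝ) 1 * (![0, 1] : Fin 2 → ℝ) 0 ≠ 0 := by simp
  generalize (![1, s] : Fin 2 → ℝ) = p at hs hpq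
  generalize (![0, 1] : Fin 2 → ℝ) = q at hpq
  have hsC : (slice (complexifyVec _ T) (fun i => (p i : ℂ))).det ≠ 0 := by
    rw [← map_slice_complexify]
    have h1 := RingHom.map_det Complex.ofRealHom (slice T p)
    rw [RingHom.mapMatrix_apply] at h1
    rw [← h1]
    exact (map_ne_zero _).2 hs
  obtain ⟨l, hl, hroot⟩ := exists_roots_of_not_isTangent ht (p := fun i => (p i : ℂ))
    (q := fun i => (q i : ℂ)) (by exact_mod_cast hpq) hsC
  -- At a nonreal root the right side of the bound is zero, so the pencil would be singular, against
  -- the choice of `p`.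
  have hreal : ∀ i, (l i).im = 0 := by
    intro i
    by_contra him
    have h0 : pencilPoly (slice T p) (slice T q) = 0 := by
      refine Polynomial.funext fun t => ?_
      have h1 := hbound p q (l i) t
      rw [complexDet_eq T p q (l i), hroot i, norm_zero, mul_zero, complexDet_ofReal,
        Complex.norm_real] at h1
      have h2 : 0 < |(l i).im| ^ n := pow_pos (abs_pos.2 him) n
      have h3 : ‖(t • slice T p + slice T q).det‖ ≤ 0 := by
        by_contra h4
        exact absurd h1 (not_le.2 (mul_pos h2 (not_le.1 h4)))
      rw [eval_pencilPoly, Polynomial.eval_zero]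
      exact norm_le_zero_iff.1 h3
    apply hs
    rw [← coeff_pencilPoly_card (slice T p) (slice T q), h0, Polynomial.coeff_zero]
  have hre : ∀ i, (((l i).re : ℝ) : ℂ) = l i := fun i =>
    Complex.ext (by simp) (by simp [hreal i])
  have hl' : Function.Injective fun i => (l i).re := by
    intro i j hij
    apply hl
    rw [← hre i, ← hre j]
    exact congrArg _ hij
  have hroot' : ∀ i, ((l i).re • slice T p + slice T q).det = 0 := by
    intro i
    have h1 := complexDet_ofReal T p q (l i).re
    rw [hre, complexDet_eq, hroot i] at h1
    exact_mod_cast h1.symm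
  obtain ⟨μ, hμ, hsign⟩ := exists_signChanges hn hs hl' hroot'
  refine mem_interior_of_open (scaleInvariant_signChanges p q μ) (isOpen_signChanges p q μ) ?_ hsign
  intro v hv hv'
  obtain ⟨h1, a, ha⟩ := hv'.hasDecomp hn hpq hμ
  exact xRank_eq hv h1 ha

end Boundary

/-! ## Polynomials vanishing on open sets of real points -/

/-- An open set contains a box with infinite sides. The map `φ` allows complex polynomials to be
tested at real points. -/
theorem eq_zero_of_eval_eq_zero_of_isOpen {σ K : Type*} [Finite σ] [Field K] (φ : ℝ →+* K)
    {P : MvPolynomial σ K} {U : Set (σ → ℝ)} (hU : IsOpen U) (hne : U.Nonempty)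
    (h : ∀ v ∈ U, MvPolynomial.eval (fun i => φ (v i)) P = 0) : P = 0 := by
  obtain ⟨v, hv⟩ := hne
  obtain ⟨u, hu, huU⟩ := isOpen_pi_iff'.1 hU v hv
  refine MvPolynomial.funext_set (fun i => φ '' u i) (fun i => ?_) fun x hx => ?_
  · exact (infinite_of_mem_nhds (v i) ((hu i).1.mem_nhds (hu i).2)).image φ.injective.injOn
  · have hx' : ∀ i, ∃ t ∈ u i, φ t = x i := fun i => hx i (Set.mem_univ i)
    choose t ht htx using hx'
    rw [map_zero, ← funext htx]
    exact h t (huU fun i _ => ht i)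

/-! ## Tensors of rank at most `n + 1` -/

section NextRank

/-- The matrix whose `i`-th column is the first column of the adjugate of `i A - B`, where `A` and
`B` are the slices of `T`. -/
def adjMatrix {R : Type*} [CommRing R] {m : ℕ} (T : TensorIdx (m + 1) → R) :
    Matrix (Fin (m + 1)) (Fin (m + 1)) R :=
  Matrix.of fun k i => adjugate (slice T ![((i : ℕ) : R), -1]) k 0

theorem adjMatrix_map {R S : Type*} [CommRing R] [CommRing S] (φ : R →+* S) {m : ℕ}
    (T : TensorIdx (m + 1) → R) : (adjMatrix T).map φ = adjMatrix fun x => φ (T x) := by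
  ext k i
  have h := RingHom.map_adjugate φ (slice T ![((i : ℕ) : R), -1])
  simp only [RingHom.mapMatrix_apply] at h
  have h1 : (fun j => φ ((![((i : ℕ) : R), -1] : Fin 2 → R) j)) = ![((i : ℕ) : S), -1] := by
    ext j
    fin_cases j <;> simp
  rw [slice_map, h1] at h
  exact congrFun (congrFun h k) 0

theorem slice_sub_eq {R : Type*} [CommRing R] {n : ℕ} (T : TensorIdx n → R) (d : R) :
    slice T ![d, -1] = d • slice T ![1, 0] - slice T ![0, 1] := by
  ext j k
  simp only [slice_apply, Matrix.sub_apply, Matrix.smul_apply, smul_eq_mul, cons_val_zero,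
    cons_val_one]
  ring

/-- The aim is a correction `u vᵀ` of `B`, with `u` the first basis vector, for which `A` and `B + u
vᵀ` have roots `d i`. The column `w i` of `W` satisfies `(d i A - B) w i = δ i u`, so the condition
is `v · w i = δ i`, solvable because `W` is invertible. Undoing the correction costs one more
summand. -/
theorem hasDecomp_succ_of_adjMatrix {K : Type*} [Field K] {m : ℕ} {T : TensorIdx (m + 1) → K}
    (h : (adjMatrix T).det ≠ 0) : HasDecomp (m + 1 + 1) T := by
  set W := adjMatrix T with hW
  have hu : IsUnit W.det := isUnit_iff_ne_zero.2 h
  let d : Fin (m + 1) → K := fun i => ((i : ℕ) : K)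
  let δ : Fin (m + 1) → K := fun i => (slice T ![d i, -1]).det
  let u : Fin (m + 1) → K := Pi.single 0 1
  let v : Fin (m + 1) → K := δ ᵥ* W⁻¹
  have hv : v ᵥ* W = δ := by
    simp only [v]
    rw [vecMul_vecMul, nonsing_inv_mul _ hu, vecMul_one]
  have hcol : ∀ i k, (slice T ![d i, -1] * W) k i = δ i * u k := by
    intro i k
    have h1 := congrFun (congrFun (mul_adjugate (slice T ![d i, -1])) k) 0
    have h2 : (slice T ![d i, -1] * W) k i =
        (slice T ![d i, -1] * adjugate (slice T ![d i, -1])) k 0 := rfl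
    rw [h2, h1, Matrix.smul_apply, smul_eq_mul, one_apply]
    simp [u, δ, Pi.single_apply]
  let T' : TensorIdx (m + 1) → K := T + pureTensor ![0, 1] u v
  have hs0 : slice T' ![1, 0] = slice T ![1, 0] := by
    simp only [T']
    rw [slice_add, slice_pureTensor]
    simp
  have hs1 : slice T' ![0, 1] = slice T ![0, 1] + vecMulVec u v := by
    simp only [T']
    rw [slice_add, slice_pureTensor]
    simp
  have hT' : HasDecomp (m + 1) T' := by
    refine hasDecomp_of_mul_diagonal (p := ![1, 0]) (q := ![0, 1]) (by simp) h (d := d) ?_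
    rw [hs0, hs1]
    ext k i
    have h1 := hcol i k
    rw [slice_sub_eq, sub_mul, smul_mul, Matrix.sub_apply, Matrix.smul_apply, smul_eq_mul] at h1
    rw [mul_diagonal, add_mul, Matrix.add_apply, vecMulVec_mul, hv, vecMulVec_apply]
    linear_combination -h1
  have hT : T = T' + pureTensor ![0, -1] u v := by
    ext ⟨i, j, k⟩
    fin_cases i <;> simp [T', pureTensor]
  rw [hT]
  exact hT'.add (hasDecomp_pureTensor _ _ _)

/-- The tensor with slices `-N` and `-1`, where `N` is the lower shift. -/
def shiftTensor (m : ℕ) : TensorIdx (m + 1) → ℝ := fun x =>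
  if x.1 = 0 then (if (x.2.1 : ℕ) = x.2.2 + 1 then -1 else 0) else (if x.2.1 = x.2.2 then -1 else 0)

/-- Here `d A - B = 1 - d N` is unipotent, and the first column of its adjugate is `(1, d, d², …)`;
the matrix is therefore a transposed Vandermonde matrix with distinct nodes. -/
theorem det_adjMatrix_shiftTensor (m : ℕ) : (adjMatrix (shiftTensor m)).det ≠ 0 := by
  have hs : ∀ (d : ℝ) (j k : Fin (m + 1)), slice (shiftTensor m) ![d, -1] j k =
      (if j = k then 1 else 0) - if (j : ℕ) = k + 1 then d else 0 := by
    intro d j k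
    simp only [slice_apply, shiftTensor, cons_val_zero, cons_val_one]
    by_cases h1 : (j : ℕ) = k + 1 <;> by_cases h2 : j = k <;> simp [h1, h2]
  have hdet : ∀ d : ℝ, (slice (shiftTensor m) ![d, -1]).det = 1 := by
    intro d
    rw [det_of_isLowerTriangular]
    · refine Finset.prod_eq_one fun i _ => ?_
      rw [hs]
      simp
    · intro j k hjk
      have hjk' : j < k := hjk
      rw [hs, if_neg hjk'.ne, if_neg, sub_zero]
      have := Fin.lt_def.1 hjk'
      omega
  have hmul : ∀ d : ℝ, slice (shiftTensor m) ![d, -1] *ᵥ (fun k : Fin (m + 1) => d ^ (k : ℕ)) =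
      Pi.single 0 1 := by
    intro d
    ext j
    simp only [mulVec, dotProduct, hs, sub_mul, Finset.sum_sub_distrib, ite_mul, one_mul, zero_mul]
    rw [Finset.sum_ite_eq, if_pos (Finset.mem_univ _)]
    induction j using Fin.cases with
    | zero => simp
    | succ j =>
      rw [Finset.sum_eq_single j.castSucc]
      · simp [pow_succ, mul_comm]
      · intro k _ hk
        rw [if_neg]
        intro h
        apply hk
        ext
        simpa using h.symm
      · simp
  have hW : adjMatrix (shiftTensor m) = (vandermonde fun i : Fin (m + 1) => ((i : ℕ) : ℝ))ᵀ := by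
    ext k i
    have h1 := congrArg (fun w => adjugate (slice (shiftTensor m) ![((i : ℕ) : ℝ), -1]) *ᵥ w)
      (hmul ((i : ℕ) : ℝ))
    simp only [mulVec_mulVec, adjugate_mul, hdet, one_smul, one_mulVec] at h1
    have h2 := congrFun h1 k
    rw [mulVec_single_one] at h2
    exact h2.symm
  rw [hW, det_transpose, det_vandermonde_ne_zero_iff]
  exact fun i j hij => Fin.ext (Nat.cast_injective hij)

/-- Both determinants are nonzero polynomials in the entries, so their product cannot vanish on a
nonempty Euclidean open set. -/
theorem exists_det_slice_and_adjMatrix_ne_zero {m : ℕ} {U : Set (TensorIdx (m + 1) → ℝ)}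
    (hU : IsOpen U) (hne : U.Nonempty) :
    ∃ T ∈ U, (slice T ![1, 0]).det ≠ 0 ∧ (adjMatrix T).det ≠ 0 := by
  let G : MvPolynomial (TensorIdx (m + 1)) ℝ :=
    (slice MvPolynomial.X ![1, 0]).det
  let H : MvPolynomial (TensorIdx (m + 1)) ℝ :=
    (adjMatrix MvPolynomial.X).det
  have hG : ∀ T : TensorIdx (m + 1) → ℝ, MvPolynomial.eval T G = (slice T ![1, 0]).det := by
    intro T
    simp only [G]
    rw [RingHom.map_det, RingHom.mapMatrix_apply, slice_map]
    congr 1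
    ext j k
    simp [slice_apply]
  have hH : ∀ T : TensorIdx (m + 1) → ℝ, MvPolynomial.eval T H = (adjMatrix T).det := by
    intro T
    simp only [H]
    rw [RingHom.map_det, RingHom.mapMatrix_apply, adjMatrix_map]
    simp
  have hG0 : G ≠ 0 := by
    intro h0
    have h1 := hG fun x => if x.2.1 = x.2.2 then 1 else 0
    have h2 : slice (fun x : TensorIdx (m + 1) => if x.2.1 = x.2.2 then (1 : ℝ) else 0) ![1, 0] =
        1 := by
      ext j k
      simp [slice_apply, one_apply]
    rw [h2, h0, map_zero, det_one] at h1
    exact zero_ne_one h1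
  have hH0 : H ≠ 0 := by
    intro h0
    have h1 := hH (shiftTensor m)
    rw [h0, map_zero] at h1
    exact det_adjMatrix_shiftTensor m h1.symm
  by_contra hcon
  push Not at hcon
  refine mul_ne_zero hG0 hH0 (eq_zero_of_eval_eq_zero_of_isOpen (RingHom.id ℝ) hU hne
    fun T hT => ?_)
  change MvPolynomial.eval T (G * H) = 0
  rw [map_mul, hG, hH]
  by_cases h : (slice T ![1, 0]).det = 0
  · rw [h, zero_mul]
  · rw [hcon T hT h, mul_zero]

end NextRank

/-! ## An open set of tensors that are not of rank `n` -/

section NegTrace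

variable {n : ℕ}

/-- For such `T`, `adj(A) B` is `det A` times a matrix conjugate to a real diagonal one, so the
trace of its square is a sum of squares. -/
theorem trace_sq_nonneg_of_hasDecomp {T : TensorIdx n → ℝ} (h : HasDecomp n T)
    (hdet : (slice T ![1, 0]).det ≠ 0) :
    0 ≤ trace ((adjugate (slice T ![1, 0]) * slice T ![0, 1]) *
      (adjugate (slice T ![1, 0]) * slice T ![0, 1])) := by
  obtain ⟨α, β, γ, rfl⟩ := h
  rw [slice_sum_pureTensor] at hdet
  rw [slice_sum_pureTensor, slice_sum_pureTensor]
  simp only [cons_val_zero, cons_val_one, mul_one, mul_zero, add_zero, zero_add] at hdet ⊢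
  set B := Matrix.of β
  set C := Matrix.of γ
  have hdet' := hdet
  rw [det_mul, det_mul, det_diagonal] at hdet'
  have hC : IsUnit C.det := isUnit_iff_ne_zero.2 (right_ne_zero_of_mul hdet')
  have hα : ∀ i, α i 0 ≠ 0 := fun i =>
    Finset.prod_ne_zero_iff.1 (right_ne_zero_of_mul (left_ne_zero_of_mul hdet')) i
      (Finset.mem_univ i)
  set A := Bᵀ * diagonal (fun i => α i 0) * C with hA
  have h1 : Bᵀ * diagonal (fun i => α i 1) * C =
      A * (C⁻¹ * diagonal (fun i => α i 1 / α i 0) * C) := by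
    have h2 : diagonal (fun i => α i 0) * diagonal (fun i => α i 1 / α i 0) =
        diagonal fun i => α i 1 := by
      rw [diagonal_mul_diagonal]
      congr 1
      ext i
      rw [mul_div_cancel₀ _ (hα i)]
    rw [hA, ← h2]
    simp only [Matrix.mul_assoc]
    rw [mul_nonsing_inv_cancel_left _ _ hC]
  rw [h1, ← Matrix.mul_assoc (adjugate A), adjugate_mul, smul_mul, Matrix.one_mul, smul_mul,
    Matrix.mul_smul, trace_smul, trace_smul, smul_smul]
  refine mul_nonneg (mul_self_nonneg _) ?_
  have h3 : C⁻¹ * diagonal (fun i => α i 1 / α i 0) * C *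
      (C⁻¹ * diagonal (fun i => α i 1 / α i 0) * C) =
      C⁻¹ * (diagonal (fun i => α i 1 / α i 0 * (α i 1 / α i 0))) * C := by
    rw [← diagonal_mul_diagonal]
    simp only [Matrix.mul_assoc]
    rw [mul_nonsing_inv_cancel_left _ _ hC]
  rw [h3, trace_mul_comm, mul_nonsing_inv_cancel_left _ _ hC, trace_diagonal]
  exact Finset.sum_nonneg fun i _ => mul_self_nonneg _

/-- A condition satisfied only by tensors of rank greater than `n`. -/
def NegTrace (T : TensorIdx n → ℝ) : Prop :=
  trace ((adjugate (slice T ![1, 0]) * slice T ![0, 1]) *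
    (adjugate (slice T ![1, 0]) * slice T ![0, 1])) < 0

theorem isOpen_negTrace : IsOpen {T : TensorIdx n → ℝ | NegTrace T} := by
  have h : Continuous fun T : TensorIdx n → ℝ => adjugate (slice T ![1, 0]) * slice T ![0, 1] :=
    (continuous_slice _).matrix_adjugate.matrix_mul (continuous_slice _)
  exact isOpen_lt (h.matrix_mul h).matrix_trace continuous_const

theorem scaleInvariant_negTrace (hn : 0 < n) : ScaleInvariant (NegTrace (n := n)) := by
  intro c T hc
  have h : adjugate (slice (c • T) ![1, 0]) * slice (c • T) ![0, 1] =
      c ^ n • (adjugate (slice T ![1, 0]) * slice T ![0, 1]) := by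
    rw [slice_smul, slice_smul, adjugate_smul, smul_mul, Matrix.mul_smul, smul_smul, Fintype.card_fin,
      ← pow_succ, Nat.sub_add_cancel hn]
  rw [NegTrace, h, smul_mul, Matrix.mul_smul, trace_smul, trace_smul, smul_smul, smul_eq_mul]
  have hpos : 0 < c ^ n * c ^ n := mul_self_pos.2 (pow_ne_zero n hc)
  constructor
  · intro h'
    by_contra h''
    exact absurd h' (not_lt.2 (mul_nonneg hpos.le (not_lt.1 h'')))
  · intro h'
    exact mul_neg_of_pos_of_neg hpos h'

theorem exists_negTrace (hn : 2 ≤ n) : ∃ T : TensorIdx n → ℝ, NegTrace T := by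
  obtain ⟨m, rfl⟩ : ∃ m, n = m + 2 := ⟨n - 2, by omega⟩
  -- An infinitesimal rotation in one plane: the trace of `J²` is `-2`.
  let J : Matrix (Fin (m + 2)) (Fin (m + 2)) ℝ := single 0 1 1 - single 1 0 1
  refine ⟨fun x => if x.1 = 0 then (1 : Matrix (Fin (m + 2)) (Fin (m + 2)) ℝ) x.2.1 x.2.2 else
    J x.2.1 x.2.2, ?_⟩
  have h0 : slice (fun x : TensorIdx (m + 2) => if x.1 = 0 then
      (1 : Matrix (Fin (m + 2)) (Fin (m + 2)) ℝ) x.2.1 x.2.2 else J x.2.1 x.2.2) ![1, 0] = 1 := by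
    ext j k
    simp [slice_apply]
  have h1 : slice (fun x : TensorIdx (m + 2) => if x.1 = 0 then
      (1 : Matrix (Fin (m + 2)) (Fin (m + 2)) ℝ) x.2.1 x.2.2 else J x.2.1 x.2.2) ![0, 1] = J := by
    ext j k
    simp [slice_apply]
  rw [NegTrace, h0, h1, adjugate_one, Matrix.one_mul]
  simp only [J, sub_mul, mul_sub, trace_sub]
  rw [single_mul_single_of_ne _ _ _ _ (by simp), single_mul_single_same, single_mul_single_same,
    single_mul_single_of_ne _ _ _ _ (by simp)]
  simp

end NegTrace

/-! ## The action of triples of matrices on tensors -/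

section Action

variable {R : Type*} [CommRing R] {n : ℕ}

/-- The tensor obtained from `T` by substituting linear forms, given by matrices, in its three
arguments. -/
def tensorAct (g : Matrix (Fin 2) (Fin 2) R) (h k : Matrix (Fin n) (Fin n) R)
    (T : TensorIdx n → R) : TensorIdx n → R :=
  fun x => (hᵀ * slice T (fun i => g i x.1) * k) x.2.1 x.2.2

theorem slice_tensorAct (g : Matrix (Fin 2) (Fin 2) R) (h k : Matrix (Fin n) (Fin n) R)
    (T : TensorIdx n → R) (a : Fin 2 → R) :
    slice (tensorAct g h k T) a = hᵀ * slice T (g *ᵥ a) * k := by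
  have h1 : g *ᵥ a = a 0 • (fun i => g i 0) + a 1 • fun i => g i 1 := by
    ext i
    simp only [mulVec, dotProduct, Fin.sum_univ_two, Pi.add_apply, Pi.smul_apply, smul_eq_mul]
    ring
  rw [h1, slice_comb, mul_add, add_mul, Matrix.mul_smul, Matrix.mul_smul, smul_mul, smul_mul]
  rfl

theorem tensorAct_tensorAct (g g' : Matrix (Fin 2) (Fin 2) R) (h h' k k' : Matrix (Fin n) (Fin n) R)
    (T : TensorIdx n → R) :
    tensorAct g' h' k' (tensorAct g h k T) = tensorAct (g * g') (h * h') (k * k') T := by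
  refine eq_of_slice_eq fun a => ?_
  rw [slice_tensorAct, slice_tensorAct, slice_tensorAct, mulVec_mulVec, transpose_mul]
  simp only [Matrix.mul_assoc]

theorem tensorAct_one (T : TensorIdx n → R) : tensorAct 1 1 1 T = T := by
  refine eq_of_slice_eq fun a => ?_
  rw [slice_tensorAct, one_mulVec, transpose_one, Matrix.one_mul, Matrix.mul_one]

theorem map_tensorAct {S : Type*} [CommRing S] (φ : R →+* S) (g : Matrix (Fin 2) (Fin 2) R)
    (h k : Matrix (Fin n) (Fin n) R) (T : TensorIdx n → R) (x : TensorIdx n) :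
    φ (tensorAct g h k T x) = tensorAct (g.map φ) (h.map φ) (k.map φ) (fun y => φ (T y)) x := by
  have h1 : (hᵀ * slice T (fun i => g i x.1) * k).map φ = (h.map φ)ᵀ *
      slice (fun y => φ (T y)) (fun i => g.map φ i x.1) * k.map φ := by
    rw [Matrix.map_mul, Matrix.map_mul, slice_map, transpose_map]
    rfl
  exact congrFun (congrFun h1 x.2.1) x.2.2

theorem HasDecomp.tensorAct {K : Type*} [Field K] {m : ℕ} {T : TensorIdx n → K}
    (hT : HasDecomp m T) (g : Matrix (Fin 2) (Fin 2) K) (h k : Matrix (Fin n) (Fin n) K) :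
    HasDecomp m (tensorAct g h k T) := by
  obtain ⟨α, β, γ, rfl⟩ := hT
  refine ⟨fun i => α i ᵥ* g, fun i => β i ᵥ* h, fun i => γ i ᵥ* k, eq_of_slice_eq fun a => ?_⟩
  rw [slice_tensorAct, slice_sum_pureTensor, slice_sum_pureTensor]
  have h1 : (Matrix.of fun i => β i ᵥ* h) = Matrix.of β * h := rfl
  have h2 : (Matrix.of fun i => γ i ᵥ* k) = Matrix.of γ * k := rfl
  rw [h1, h2, transpose_mul]
  simp only [Matrix.mul_assoc]
  congr 4
  ext i
  simp only [mulVec, vecMul, dotProduct, Fin.sum_univ_two]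
  ring

theorem continuous_tensorAct [TopologicalSpace R] [IsTopologicalRing R]
    (g : Matrix (Fin 2) (Fin 2) R) (h k : Matrix (Fin n) (Fin n) R) :
    Continuous (tensorAct g h k : (TensorIdx n → R) → TensorIdx n → R) := by
  refine continuous_pi fun x => ?_
  exact ((continuous_const.matrix_mul (continuous_slice _)).matrix_mul
    continuous_const).matrix_elem _ _

theorem det_slice_tensorAct (g : Matrix (Fin 2) (Fin 2) R) (h k : Matrix (Fin n) (Fin n) R)
    (T : TensorIdx n → R) (a : Fin 2 → R) :
    (slice (tensorAct g h k T) a).det = h.det * (slice T (g *ᵥ a)).det * k.det := by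
  rw [slice_tensorAct, det_mul, det_mul, det_transpose]

end Action

/-! ## Tensors tangent at the base point -/

section Normal

variable {m : ℕ}

/-- Set to zero the coordinates of a tensor that have to vanish for its hyperplane to be tangent to
the Segre variety at the point given by three first basis vectors. -/
def tangentPart {R : Type*} [CommRing R] (T : TensorIdx (m + 2) → R) : TensorIdx (m + 2) → R :=
  fun x => if (x.2.1 = 0 ∧ x.2.2 = 0) ∨ (x.1 = 0 ∧ (x.2.1 = 0 ∨ x.2.2 = 0)) then 0 else T x

/-- The decomposable tensor of three first basis vectors. -/
def baseTensor (R : Type*) [CommRing R] (m : ℕ) : TensorIdx (m + 2) → R :=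
  fun x => if x.1 = 0 ∧ x.2.1 = 0 ∧ x.2.2 = 0 then 1 else 0

/-- `T` is tangent at the base point. -/
def IsNormal {R : Type*} [CommRing R] (T : TensorIdx (m + 2) → R) : Prop :=
  (∀ i, T (i, 0, 0) = 0) ∧ (∀ j, T (0, 0, j) = 0) ∧ ∀ j, T (0, j, 0) = 0

theorem isNormal_tangentPart {R : Type*} [CommRing R] (T : TensorIdx (m + 2) → R) :
    IsNormal (tangentPart T) :=
  ⟨fun i => by simp [tangentPart], fun j => by simp [tangentPart], fun j => by simp [tangentPart]⟩

theorem IsNormal.tangentPart_eq {R : Type*} [CommRing R] {T : TensorIdx (m + 2) → R}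
    (h : IsNormal T) : tangentPart T = T := by
  obtain ⟨h1, h2, h3⟩ := h
  ext ⟨i, j, k⟩
  rw [tangentPart]
  split_ifs with hx
  · rcases hx with ⟨hj, hk⟩ | ⟨hi, hj | hk⟩
    · simp only at hj hk
      rw [hj, hk, h1]
    · simp only at hi hj
      rw [hi, hj, h2]
    · simp only at hi hk
      rw [hi, hk, h3]
  · rfl

theorem slice_baseTensor {R : Type*} [CommRing R] (a : Fin 2 → R) :
    slice (baseTensor R m) a = a 0 • single 0 0 1 := by
  ext j k
  simp only [slice_apply, baseTensor, Matrix.smul_apply, single_apply, smul_eq_mul]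
  simp [eq_comm]

/-- The determinant of the first slice of a normal tensor perturbed by a multiple of the base
tensor. -/
theorem det_add_smul_single {R : Type*} [CommRing R] {A : Matrix (Fin (m + 2)) (Fin (m + 2)) R}
    (hA : ∀ j, A 0 j = 0) (ε : R) :
    (A + ε • single 0 0 1).det = ε * (A + single 0 0 1).det := by
  set B : Matrix (Fin (m + 2)) (Fin (m + 2)) R := A + single 0 0 1 with hB
  -- Since row `0` of `A` is zero, scaling the corner entry scales the whole row.
  have h : A + ε • single 0 0 1 = B.updateRow 0 (ε • B 0) := by
    ext j k
    by_cases hj : j = 0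
    · subst hj
      simp [hB, hA, single_apply]
    · simp [hB, hj, Ne.symm hj]
  rw [h, det_updateRow_smul, updateRow_eq_self]

/-- A regular normal tensor whose kernel at the base point is one-dimensional is not a sum of
`m + 2` decomposable tensors. -/
theorem IsNormal.not_hasDecomp {K : Type*} [Field K] {T : TensorIdx (m + 2) → K}
    (h : IsNormal T) (hκ : (slice T ![1, 0] + single 0 0 1).det ≠ 0) {a : Fin 2 → K}
    (ha : (slice T a).det ≠ 0) : ¬ HasDecomp (m + 2) T := by
  rintro ⟨α, β, γ, hT⟩
  obtain ⟨h1, h2, h3⟩ := h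
  have hs : ∀ a, slice T a = (Matrix.of β)ᵀ *
      diagonal (fun i => α i 0 * a 0 + α i 1 * a 1) * Matrix.of γ := fun a => by
    rw [hT, slice_sum_pureTensor]
  rw [hs, det_mul, det_mul, det_diagonal, det_transpose] at ha
  have hγ : (Matrix.of γ).det ≠ 0 := right_ne_zero_of_mul ha
  have hβ : (Matrix.of β).det ≠ 0 := left_ne_zero_of_mul (left_ne_zero_of_mul ha)
  have hα : ∀ i, α i 0 = 0 → α i 1 ≠ 0 := by
    intro i hi0 hi1
    have := Finset.prod_ne_zero_iff.1 (right_ne_zero_of_mul (left_ne_zero_of_mul ha)) i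
      (Finset.mem_univ i)
    rw [hi0, hi1] at this
    simp at this
  have hcoord : ∀ i j k, T (i, j, k) = ∑ l, α l i * β l j * γ l k := by
    intro i j k
    rw [hT, Finset.sum_apply]
    rfl
  -- The vanishing of the entries `T (0, j, 0)` is a linear relation among the independent rows of
  -- `β`.
  have hw : ∀ l, α l 0 * γ l 0 = 0 := by
    have : (Matrix.of β)ᵀ *ᵥ (fun l => α l 0 * γ l 0) = 0 := by
      ext j
      rw [Pi.zero_apply, ← h3 j, hcoord, mulVec, dotProduct]
      refine Finset.sum_congr rfl fun l _ => ?_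
      rw [transpose_apply, of_apply]
      ring
    have h0 := eq_zero_of_mulVec_eq_zero (by rwa [det_transpose]) this
    exact fun l => congrFun h0 l
  have hu : ∀ l, α l 0 * β l 0 = 0 := by
    have : (Matrix.of γ)ᵀ *ᵥ (fun l => α l 0 * β l 0) = 0 := by
      ext j
      rw [Pi.zero_apply, ← h2 j, hcoord, mulVec, dotProduct]
      refine Finset.sum_congr rfl fun l _ => ?_
      rw [transpose_apply, of_apply]
      ring
    have h0 := eq_zero_of_mulVec_eq_zero (by rwa [det_transpose]) this
    exact fun l => congrFun h0 l
  -- In the coordinates given by `γ`, the kernel of the first slice is spanned by the basis vectors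
  -- `l` with `α l 0 = 0`. By `hκ`, a kernel vector with first coordinate zero vanishes, so the
  -- kernel has dimension at most one.
  have huniq : ∀ i j, α i 0 = 0 → α j 0 = 0 → i = j := by
    intro i j hi hj
    by_contra hij
    have hker : ∀ z : Fin (m + 2) → K, (∀ l, α l 0 * z l = 0) →
        ((Matrix.of γ)⁻¹ *ᵥ z) 0 = 0 → z = 0 := by
      intro z hz hz0
      set v := (Matrix.of γ)⁻¹ *ᵥ z with hv
      have hγv : Matrix.of γ *ᵥ v = z := by
        rw [hv, mulVec_mulVec, mul_nonsing_inv _ (isUnit_iff_ne_zero.2 hγ), one_mulVec]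
      have hdz : diagonal (fun l => α l 0 * (![1, 0] : Fin 2 → K) 0 +
          α l 1 * (![1, 0] : Fin 2 → K) 1) *ᵥ z = 0 := by
        ext l
        rw [mulVec_diagonal]
        simpa using hz l
      have hv0 : (slice T ![1, 0] + single 0 0 1) *ᵥ v = 0 := by
        rw [add_mulVec, hs, ← mulVec_mulVec, hγv, ← mulVec_mulVec, hdz, mulVec_zero, zero_add,
          single_mulVec]
        ext l
        simp [hz0, Function.update_apply]
      rw [← hγv, eq_zero_of_mulVec_eq_zero hκ hv0, mulVec_zero]
    let x : Fin (m + 2) → K := Pi.single i 1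
    let y : Fin (m + 2) → K := Pi.single j 1
    let s := ((Matrix.of γ)⁻¹ *ᵥ x) 0
    let t := ((Matrix.of γ)⁻¹ *ᵥ y) 0
    have hx0 : ∀ l, α l 0 * x l = 0 := by
      intro l
      by_cases hl : l = i
      · rw [hl, hi, zero_mul]
      · simp [x, hl]
    have hy0 : ∀ l, α l 0 * y l = 0 := by
      intro l
      by_cases hl : l = j
      · rw [hl, hj, zero_mul]
      · simp [y, hl]
    have hs0 : s ≠ 0 := by
      intro hs0
      have := congrFun (hker x hx0 hs0) i
      simp [x] at this
    have hz := hker (t • x - s • y) (fun l => by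
      simp only [Pi.sub_apply, Pi.smul_apply, smul_eq_mul]
      linear_combination t * hx0 l - s * hy0 l) (by
      rw [mulVec_sub, mulVec_smul, mulVec_smul, Pi.sub_apply, Pi.smul_apply, Pi.smul_apply,
        smul_eq_mul, smul_eq_mul]
      change t * s - s * t = 0
      ring)
    have := congrFun hz j
    simp [x, y, Ne.symm hij, hs0] at this
  obtain ⟨i, hi⟩ : ∃ i, γ i 0 ≠ 0 := by
    by_contra hcon
    push Not at hcon
    exact hγ (det_eq_zero_of_column_eq_zero 0 hcon)
  obtain ⟨j, hj⟩ : ∃ j, β j 0 ≠ 0 := by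
    by_contra hcon
    push Not at hcon
    exact hβ (det_eq_zero_of_column_eq_zero 0 hcon)
  have hi0 : α i 0 = 0 := (mul_eq_zero.1 (hw i)).resolve_right hi
  have hj0 : α j 0 = 0 := (mul_eq_zero.1 (hu j)).resolve_right hj
  have hij := huniq i j hi0 hj0
  subst hij
  -- Only the index `i` survives in the entry `T (1, 0, 0)`, where its term is nonzero.
  have h4 := h1 1
  rw [hcoord, Finset.sum_eq_single i] at h4
  · exact mul_ne_zero (mul_ne_zero (hα i hi0) hj) hi h4
  · intro l _ hl
    have : γ l 0 = 0 :=
      (mul_eq_zero.1 (hw l)).resolve_left fun hl0 => hl (huniq l i hl0 hi0)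
    rw [this, mul_zero]
  · simp

end Normal

/-! ## Normal tensors on the boundary of the locus of rank `n` -/

section NormalBoundary

variable {m : ℕ}

/-- The determinant of the pencil with slices `A`, `B` of `T` at `A + t B`. -/
def pencilDet (T : TensorIdx (m + 2) → ℝ) (t : ℝ) : ℝ :=
  (t • slice T ![0, 1] + slice T ![1, 0]).det

/-- The determinant of the first slice of `T + E`, where `E` is the base tensor. -/
def cornerDet (T : TensorIdx (m + 2) → ℝ) : ℝ := (slice T ![1, 0] + single 0 0 1).det

/-- Sign conditions that make perturbations of a normal tensor `T` by small positive multiples of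
the base tensor have real roots. -/
def AlternatingSigns (T : TensorIdx (m + 2) → ℝ) : Prop :=
  pencilDet T (-1) * cornerDet T < 0 ∧ cornerDet T * pencilDet T 1 < 0 ∧
    ∀ i : Fin m, pencilDet T ((i : ℕ) + 1) * pencilDet T ((i : ℕ) + 2) < 0

theorem continuous_pencilDet (t : ℝ) :
    Continuous fun T : TensorIdx (m + 2) → ℝ => pencilDet T t := continuous_det_pencil _ _ _

theorem continuous_cornerDet : Continuous (cornerDet : (TensorIdx (m + 2) → ℝ) → ℝ) :=
  ((continuous_slice _).add continuous_const).matrix_det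

theorem isOpen_alternatingSigns : IsOpen {T : TensorIdx (m + 2) → ℝ | AlternatingSigns T} := by
  simp only [AlternatingSigns, Set.ofPred_and, Set.ofPred_forall]
  refine IsOpen.inter ?_ (IsOpen.inter ?_ (isOpen_iInter_of_finite fun i => ?_))
  · exact isOpen_lt ((continuous_pencilDet _).mul continuous_cornerDet) continuous_const
  · exact isOpen_lt (continuous_cornerDet.mul (continuous_pencilDet _)) continuous_const
  · exact isOpen_lt ((continuous_pencilDet _).mul (continuous_pencilDet _)) continuous_const

open Filter Topology in
-- The pencil of `T` has a double root at `t = 0`. The perturbation makes the value there `ε *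
-- cornerDet T`, of sign opposite to those at `-1` and `1`, so the double root splits into two real
-- ones. The remaining sign changes, at `1, 2, …, m + 1`, survive by continuity.
theorem IsNormal.eventually_signChanges {T : TensorIdx (m + 2) → ℝ} (h : IsNormal T)
    (hT : AlternatingSigns T) : ∀ᶠ ε in 𝓝[>] (0 : ℝ),
      SignChanges ![0, 1] ![1, 0] (fun k : Fin (m + 2 + 1) => ((k : ℕ) : ℝ) - 1)
        (T + ε • baseTensor ℝ m) := by
  have hcont : Continuous fun ε : ℝ => T + ε • baseTensor ℝ m := by fun_prop
  have hc : ∀ t, Continuous fun ε : ℝ => pencilDet (T + ε • baseTensor ℝ m) t :=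
    fun t => (continuous_pencilDet t).comp hcont
  have h0 : ∀ ε, pencilDet (T + ε • baseTensor ℝ m) 0 = ε * cornerDet T := by
    intro ε
    rw [pencilDet, zero_smul, zero_add, slice_add, slice_smul, slice_baseTensor, cons_val_zero,
      one_smul, det_add_smul_single, cornerDet]
    intro j
    simp [slice_apply, h.2.1]
  obtain ⟨h1, h2, h3⟩ := hT
  have e1 : ∀ᶠ ε in 𝓝[>] (0 : ℝ), pencilDet (T + ε • baseTensor ℝ m) (-1) * cornerDet T < 0 := by
    refine (((hc (-1)).mul continuous_const).tendsto 0).eventually_lt_const ?_ |>.filter_mono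
      nhdsWithin_le_nhds
    simpa using h1
  have e2 : ∀ᶠ ε in 𝓝[>] (0 : ℝ), cornerDet T * pencilDet (T + ε • baseTensor ℝ m) 1 < 0 := by
    refine ((continuous_const.mul (hc 1)).tendsto 0).eventually_lt_const ?_ |>.filter_mono
      nhdsWithin_le_nhds
    simpa using h2
  have e3 : ∀ᶠ ε in 𝓝[>] (0 : ℝ), ∀ i : Fin m, pencilDet (T + ε • baseTensor ℝ m) ((i : ℕ) + 1) *
      pencilDet (T + ε • baseTensor ℝ m) ((i : ℕ) + 2) < 0 := by
    rw [eventually_all]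
    intro i
    refine (((hc _).mul (hc _)).tendsto 0).eventually_lt_const ?_ |>.filter_mono
      nhdsWithin_le_nhds
    simpa using h3 i
  filter_upwards [e1, e2, e3, self_mem_nhdsWithin] with ε h1 h2 h3 hε
  have hε' : 0 < ε := hε
  intro i
  change pencilDet (T + ε • baseTensor ℝ m) (((i.castSucc : Fin (m + 3)) : ℕ) - 1) *
    pencilDet (T + ε • baseTensor ℝ m) (((i.succ : Fin (m + 3)) : ℕ) - 1) < 0
  induction i using Fin.cases with
  | zero =>
    have hl : (((Fin.castSucc (0 : Fin (m + 2)) : Fin (m + 3)) : ℕ) : ℝ) - 1 = -1 := by simp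
    have hr : (((Fin.succ (0 : Fin (m + 2)) : Fin (m + 3)) : ℕ) : ℝ) - 1 = 0 := by simp
    rw [hl, hr, h0, mul_left_comm]
    exact mul_neg_of_pos_of_neg hε' h1
  | succ i =>
    induction i using Fin.cases with
    | zero =>
      have hl : (((Fin.castSucc (Fin.succ (0 : Fin (m + 1))) : Fin (m + 3)) : ℕ) : ℝ) - 1 = 0 := by
        simp
      have hr : (((Fin.succ (Fin.succ (0 : Fin (m + 1))) : Fin (m + 3)) : ℕ) : ℝ) - 1 = 1 := by
        rw [Fin.val_succ, Fin.val_succ, Fin.val_zero]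
        norm_num
      rw [hl, hr, h0, mul_assoc]
      exact mul_neg_of_pos_of_neg hε' h2
    | succ i =>
      have hl : (((Fin.castSucc i.succ.succ : Fin (m + 3)) : ℕ) : ℝ) - 1 = (i : ℕ) + 1 := by
        rw [Fin.val_castSucc, Fin.val_succ, Fin.val_succ]
        push_cast
        ring
      have hr : (((Fin.succ i.succ.succ : Fin (m + 3)) : ℕ) : ℝ) - 1 = (i : ℕ) + 2 := by
        rw [Fin.val_succ, Fin.val_succ, Fin.val_succ]
        push_cast
        ring
      rw [hl, hr]
      exact h3 i

theorem strictMono_natCast_sub_one (n : ℕ) : StrictMono fun k : Fin n => ((k : ℕ) : ℝ) - 1 := by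
  intro i j hij
  have : ((i : ℕ) : ℝ) < ((j : ℕ) : ℝ) := by exact_mod_cast hij
  simpa using this

theorem AlternatingSigns.cornerDet_ne_zero {T : TensorIdx (m + 2) → ℝ} (hT : AlternatingSigns T) :
    cornerDet T ≠ 0 := right_ne_zero_of_mul hT.1.ne

theorem AlternatingSigns.exists_det_ne_zero {T : TensorIdx (m + 2) → ℝ} (hT : AlternatingSigns T) :
    ∃ a, (slice T a).det ≠ 0 := by
  refine ⟨(-1 : ℝ) • ![0, 1] + (1 : ℝ) • ![1, 0], ?_⟩
  rw [slice_comb, one_smul]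
  exact left_ne_zero_of_mul hT.1.ne

open Filter Topology in
/-- The transforms of normal tensors with alternating signs lie on the boundary of the locus of
tensors of rank `m + 2`. -/
theorem IsNormal.mem_boundary {T : TensorIdx (m + 2) → ℝ} (h : IsNormal T)
    (hT : AlternatingSigns T) {g : Matrix (Fin 2) (Fin 2) ℝ}
    {h' k : Matrix (Fin (m + 2)) (Fin (m + 2)) ℝ} (hg : g.det ≠ 0) (hh : h'.det ≠ 0)
    (hk : k.det ≠ 0) : ∃ hne : tensorAct g h' k T ≠ 0,
      Projectivization.mk ℝ (tensorAct g h' k T) hne ∈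
        closure {f | xRank (segre ℝ (m + 2)) f = (m + 2 : ℕ)} \
          interior {f | xRank (segre ℝ (m + 2)) f = (m + 2 : ℕ)} := by
  have hgu := isUnit_iff_ne_zero.2 hg
  have hhu := isUnit_iff_ne_zero.2 hh
  have hku := isUnit_iff_ne_zero.2 hk
  have hinv : ∀ U : TensorIdx (m + 2) → ℝ,
      tensorAct g⁻¹ h'⁻¹ k⁻¹ (tensorAct g h' k U) = U := by
    intro U
    rw [tensorAct_tensorAct, mul_nonsing_inv _ hgu, mul_nonsing_inv _ hhu, mul_nonsing_inv _ hku,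
      tensorAct_one]
  -- The action of invertible matrices is reversible, so it preserves the obstruction of
  -- `IsNormal.not_hasDecomp`.
  have hdec : ¬ HasDecomp (m + 2) (tensorAct g h' k T) := by
    intro hd
    obtain ⟨a, ha⟩ := hT.exists_det_ne_zero
    refine h.not_hasDecomp hT.cornerDet_ne_zero ha ?_
    rw [← hinv T]
    exact hd.tensorAct _ _ _
  have hne : tensorAct g h' k T ≠ 0 := fun h0 => hdec (by rw [h0]; exact hasDecomp_zero _)
  refine ⟨hne, ?_, fun hint => ?_⟩
  swap
  · have hmem := interior_subset hint
    exact hdec (hasDecomp_of_xRank_eq hne hmem)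
  rw [mem_closure_iff]
  intro V hV hTV
  have hVo := isOpen_setOf_mk_mem hV
  have hcont : Continuous fun ε : ℝ => tensorAct g h' k (T + ε • baseTensor ℝ m) :=
    (continuous_tensorAct g h' k).comp (by fun_prop)
  have hev : ∀ᶠ ε in 𝓝[>] (0 : ℝ), tensorAct g h' k (T + ε • baseTensor ℝ m) ∈
      {v : TensorIdx (m + 2) → ℝ | ∃ h : v ≠ 0, Projectivization.mk ℝ v h ∈ V} := by
    refine (hcont.tendsto 0).eventually (hVo.mem_nhds ?_) |>.filter_mono nhdsWithin_le_nhds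
    rw [zero_smul, add_zero]
    exact ⟨hne, hTV⟩
  obtain ⟨ε, ⟨hε0, hεV⟩, hε⟩ := (hev.and (h.eventually_signChanges hT)).exists
  refine ⟨_, hεV, ?_⟩
  obtain ⟨hd, a, ha⟩ := hε.hasDecomp (by omega) (by simp) (strictMono_natCast_sub_one _)
  refine xRank_eq (a := g⁻¹ *ᵥ a) _ (hd.tensorAct g h' k) ?_
  rw [det_slice_tensorAct, mulVec_mulVec, mul_nonsing_inv _ hgu, one_mulVec]
  exact mul_ne_zero (mul_ne_zero hh ha) hk

/-- A normal tensor with a real double root at the base point and `m` further real roots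
`3/2, 5/2, …`. -/
noncomputable def modelTensor (m : ℕ) : TensorIdx (m + 2) → ℝ := fun x =>
  if x.1 = 0 then
    diagonal (Fin.cons 0 (Fin.cons 1 fun i : Fin m => ((i : ℕ) : ℝ) + 3 / 2)) x.2.1 x.2.2
  else (single 0 1 1 + single 1 0 1 + diagonal (Fin.cons 0 (Fin.cons 0 fun _ : Fin m => -1)) :
    Matrix (Fin (m + 2)) (Fin (m + 2)) ℝ) x.2.1 x.2.2

theorem isNormal_modelTensor (m : ℕ) : IsNormal (modelTensor m) := by
  refine ⟨fun i => ?_, fun j => ?_, fun j => ?_⟩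
  · fin_cases i <;> simp [modelTensor]
  · by_cases hj : 0 = j
    · simp [modelTensor, ← hj]
    · simp [modelTensor, hj]
  · by_cases hj : j = 0
    · simp [modelTensor, hj]
    · simp [modelTensor, hj]

/-- Subtracting `y` times row `1` from row `0` makes the matrix lower triangular. -/
theorem det_block_diagonal (ε y : ℝ) (d : Fin m → ℝ) :
    (diagonal (Fin.cons ε (Fin.cons 1 d)) + y • (single 0 1 1 + single 1 0 1) :
      Matrix (Fin (m + 2)) (Fin (m + 2)) ℝ).det = (ε - y ^ 2) * ∏ i, d i := by
  set M : Matrix (Fin (m + 2)) (Fin (m + 2)) ℝ :=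
    diagonal (Fin.cons ε (Fin.cons 1 d)) + y • (single 0 1 1 + single 1 0 1) with hM
  rw [← det_updateRow_add_smul_self M (zero_ne_one) (-y), det_of_isLowerTriangular]
  · rw [Fin.prod_univ_succ, Fin.prod_univ_succ]
    have h0 : M.updateRow 0 (M 0 + -y • M 1) 0 0 = ε - y ^ 2 := by
      simp [hM]
      ring
    have h1 : M.updateRow 0 (M 0 + -y • M 1) (Fin.succ 0) (Fin.succ 0) = 1 := by
      rw [updateRow_ne (Fin.succ_ne_zero 0)]
      simp [hM]
    have h2 : ∀ i : Fin m, M.updateRow 0 (M 0 + -y • M 1) i.succ.succ i.succ.succ = d i := by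
      intro i
      have e1 : (0 : Fin (m + 2)) ≠ i.succ.succ := (Fin.succ_ne_zero _).symm
      rw [updateRow_ne (Fin.succ_ne_zero _)]
      simp [hM, e1]
    simp only [h0, h1, h2, one_mul]
  · intro j k hjk
    have hjk' : j < k := hjk
    induction j using Fin.cases with
    | zero =>
      induction k using Fin.cases with
      | zero => exact absurd hjk' (lt_irrefl _)
      | succ k =>
        induction k using Fin.cases with
        | zero => simp [hM]
        | succ k =>
          have e1 : (0 : Fin (m + 2)) ≠ k.succ.succ := (Fin.succ_ne_zero _).symm
          have e2 : (1 : Fin (m + 2)) ≠ k.succ.succ := by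
            intro h
            exact (Fin.succ_ne_zero k).symm (Fin.succ_injective _ h)
          simp [hM, e1, e2]
    | succ j =>
      have e1 : (0 : Fin (m + 2)) ≠ j.succ := (Fin.succ_ne_zero _).symm
      have e2 : (0 : Fin (m + 2)) ≠ k := (lt_of_le_of_lt (Fin.zero_le _) hjk').ne
      rw [updateRow_ne e1.symm]
      simp [hM, e1, e2, hjk'.ne]

theorem pencilDet_modelTensor (y : ℝ) :
    pencilDet (modelTensor m) y = -y ^ 2 * ∏ i : Fin m, (((i : ℕ) : ℝ) + 3 / 2 - y) := by
  rw [← zero_sub, ← det_block_diagonal, pencilDet]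
  congr 1
  ext j k
  simp only [slice_apply, modelTensor, Matrix.add_apply, Matrix.smul_apply, smul_eq_mul]
  by_cases hjk : j = k
  · subst hjk
    induction j using Fin.cases with
    | zero => simp
    | succ j =>
      induction j using Fin.cases with
      | zero => simp
      | succ j =>
        simp [mul_add]
        ring
  · simp [hjk]

theorem cornerDet_modelTensor :
    cornerDet (modelTensor m) = ∏ i : Fin m, (((i : ℕ) : ℝ) + 3 / 2) := by
  have h := det_block_diagonal (m := m) 1 0 fun i => ((i : ℕ) : ℝ) + 3 / 2
  rw [zero_smul, add_zero] at h
  have h1 : cornerDet (modelTensor m) =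
      (diagonal (Fin.cons 1 (Fin.cons 1 fun i : Fin m => ((i : ℕ) : ℝ) + 3 / 2)) :
        Matrix (Fin (m + 2)) (Fin (m + 2)) ℝ).det := by
    rw [cornerDet]
    congr 1
    ext j k
    simp only [slice_apply, modelTensor, Matrix.add_apply]
    by_cases hjk : j = k
    · subst hjk
      induction j using Fin.cases with
      | zero => simp
      | succ j => simp [(Fin.succ_ne_zero j).symm]
    · by_cases hj : 0 = j
      · subst hj
        simp [hjk]
      · simp [hjk, single_apply, hj]
  rw [h1, h]
  ring

theorem alternatingSigns_modelTensor (m : ℕ) : AlternatingSigns (modelTensor m) := by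
  have hκ : 0 < cornerDet (modelTensor m) := by
    rw [cornerDet_modelTensor]
    exact Finset.prod_pos fun i _ => by positivity
  refine ⟨mul_neg_of_neg_of_pos ?_ hκ, mul_neg_of_pos_of_neg hκ ?_, fun i => ?_⟩
  · rw [pencilDet_modelTensor]
    refine mul_neg_of_neg_of_pos (by norm_num) (Finset.prod_pos fun i _ => ?_)
    have : (0 : ℝ) ≤ ((i : ℕ) : ℝ) := Nat.cast_nonneg _
    linarith
  · rw [pencilDet_modelTensor]
    refine mul_neg_of_neg_of_pos (by norm_num) (Finset.prod_pos fun i _ => ?_)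
    have : (0 : ℝ) ≤ ((i : ℕ) : ℝ) := Nat.cast_nonneg _
    linarith
  · have hi : (0 : ℝ) ≤ ((i : ℕ) : ℝ) := Nat.cast_nonneg _
    rw [pencilDet_modelTensor, pencilDet_modelTensor, mul_mul_mul_comm, ← Finset.prod_mul_distrib,
      neg_mul_neg]
    refine mul_neg_of_pos_of_neg (by positivity) ?_
    rw [← Finset.mul_prod_erase _ _ (Finset.mem_univ i)]
    -- The root `i + 3/2` is the only one between `i + 1` and `i + 2`; its two factors are `1/2` and
    -- `-1/2`.
    refine mul_neg_of_neg_of_pos (by ring_nf; norm_num) (Finset.prod_pos fun k hk => ?_)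
    have hne : (k : ℕ) ≠ i := fun h => Finset.ne_of_mem_erase hk (Fin.ext h)
    rcases lt_or_gt_of_ne hne with hlt | hlt
    · have : ((k : ℕ) : ℝ) + 1 ≤ ((i : ℕ) : ℝ) := by exact_mod_cast hlt
      exact mul_pos_of_neg_of_neg (by linarith) (by linarith)
    · have : ((i : ℕ) : ℝ) + 1 ≤ ((k : ℕ) : ℝ) := by exact_mod_cast hlt
      exact mul_pos (by linarith) (by linarith)

end NormalBoundary

/-! ## A parametrization of the tangent tensors -/

section Parametrization

variable {m : ℕ}

/-- The coordinates of three matrices and a tensor. -/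
abbrev ParamIdx (m : ℕ) : Type :=
  (Fin 2 × Fin 2) ⊕ (Fin (m + 2) × Fin (m + 2)) ⊕ (Fin (m + 2) × Fin (m + 2)) ⊕ TensorIdx (m + 2)

/-- The transform of the normal part of a tensor under three matrices. -/
def param {R : Type*} [CommRing R] (w : ParamIdx m → R) : TensorIdx (m + 2) → R :=
  tensorAct (Matrix.of fun i j => w (Sum.inl (i, j)))
    (Matrix.of fun i j => w (Sum.inr (Sum.inl (i, j))))
    (Matrix.of fun i j => w (Sum.inr (Sum.inr (Sum.inl (i, j)))))
    (tangentPart fun x => w (Sum.inr (Sum.inr (Sum.inr x))))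

theorem map_param {R S : Type*} [CommRing R] [CommRing S] (φ : R →+* S) (w : ParamIdx m → R) :
    (fun x => φ (param w x)) = param fun i => φ (w i) := by
  ext x
  rw [param, map_tensorAct, param]
  congr 1
  ext y
  simp only [tangentPart]
  split_ifs
  · exact map_zero φ
  · rfl

theorem eval_bind₁_param (w : ParamIdx m → ℂ) (F : MvPolynomial (TensorIdx (m + 2)) ℂ) :
    MvPolynomial.eval w (MvPolynomial.bind₁ (param MvPolynomial.X) F) =
      MvPolynomial.eval (param w) F := by
  have h := map_param (MvPolynomial.eval w) (MvPolynomial.X : ParamIdx m → MvPolynomial _ ℂ)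
  simp only [MvPolynomial.eval_X] at h
  rw [← h]
  exact MvPolynomial.eval₂Hom_bind₁ _ _ _ _

/-- Every nonzero vector is the first column of an invertible matrix. -/
theorem exists_mulVec_single_eq {K : Type*} [Field K] {k : ℕ} {v : Fin (k + 1) → K} (hv : v ≠ 0) :
    ∃ M : Matrix (Fin (k + 1)) (Fin (k + 1)) K, M.det ≠ 0 ∧ M *ᵥ Pi.single 0 1 = v := by
  obtain ⟨i, hi⟩ := Function.ne_iff.1 hv
  refine ⟨((1 : Matrix (Fin (k + 1)) (Fin (k + 1)) K).updateCol i v).submatrix id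
    (Equiv.swap 0 i), ?_, ?_⟩
  · rw [det_permute']
    refine mul_ne_zero (by simp only [Equiv.Perm.sign_swap']; split_ifs <;> simp) ?_
    -- By Cramer's rule, the identity with column `i` replaced by `v` has determinant `v i`.
    rw [← cramer_apply, cramer_one]
    exact hi
  · rw [mulVec_single_one]
    ext j
    simp

/-- Invertible matrices move the point of tangency to the base point, where tangency is just the
vanishing of certain coordinates; the inverse matrices recover `T`. -/
theorem exists_param_eq {K : Type*} [Field K] {T : TensorIdx (m + 2) → K} (h : IsTangent T) :
    ∃ w, param w = T := by
  obtain ⟨a, b, c, ha, hb, hc, hNc, hbN, hbc⟩ := h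
  obtain ⟨g, hg, hga⟩ := exists_mulVec_single_eq ha
  obtain ⟨h', hh, hhb⟩ := exists_mulVec_single_eq hb
  obtain ⟨k, hk, hkc⟩ := exists_mulVec_single_eq hc
  have hgu := isUnit_iff_ne_zero.2 hg
  have hhu := isUnit_iff_ne_zero.2 hh
  have hku := isUnit_iff_ne_zero.2 hk
  set L := tensorAct g h' k T with hL
  have hbase : ∀ (e : Fin 2 → K) (j l : Fin (m + 2)), slice L e j l =
      (h' *ᵥ Pi.single j 1) ⬝ᵥ slice T (g *ᵥ e) *ᵥ (k *ᵥ Pi.single l 1) := by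
    intro e j l
    rw [hL, slice_tensorAct, mulVec_single_one, mulVec_single_one, dotProduct_mulVec]
    rfl
  have hcoord : ∀ i j l, L (i, j, l) = slice L (Pi.single i 1) j l := by
    intro i j l
    rw [slice_apply]
    fin_cases i <;> simp
  have hnorm : IsNormal L := by
    refine ⟨fun i => ?_, fun j => ?_, fun j => ?_⟩
    · rw [hcoord, hbase, hhb, hkc, hbc]
    · rw [hcoord, hbase, hhb, hga, dotProduct_mulVec, hbN, zero_dotProduct]
    · rw [hcoord, hbase, hkc, hga, hNc, dotProduct_zero]
  refine ⟨Sum.elim (fun x => g⁻¹ x.1 x.2) (Sum.elim (fun x => h'⁻¹ x.1 x.2)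
    (Sum.elim (fun x => k⁻¹ x.1 x.2) L)), ?_⟩
  change tensorAct g⁻¹ h'⁻¹ k⁻¹ (tangentPart L) = T
  rw [hnorm.tangentPart_eq, hL, tensorAct_tensorAct, mul_nonsing_inv _ hgu, mul_nonsing_inv _ hhu,
    mul_nonsing_inv _ hku, tensorAct_one]

theorem complexifyPoint_mk {ι : Type*} {v : ι → ℝ} (hv : v ≠ 0) :
    ∃ h : complexifyVec ι v ≠ 0,
      complexifyPoint (Projectivization.mk ℝ v hv) = Projectivization.mk ℂ (complexifyVec ι v) h :=
  ⟨fun h0 => hv (complexifyVec_injective ι (h0.trans (map_zero _).symm)),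
    Projectivization.map_mk _ _ _ _⟩

/-- The boundary of the locus of real tensors of rank `n`. -/
def rankBoundary (n : ℕ) : Set (ℙ ℝ (TensorIdx n → ℝ)) :=
  closure {f | xRank (segre ℝ n) f = n} \ interior {f | xRank (segre ℝ n) f = n}

/-- A form vanishing on the boundary of the locus of real tensors of rank `n` vanishes on all
tangent tensors. -/
theorem bind₁_param_eq_zero {F : MvPolynomial (TensorIdx (m + 2)) ℂ} {d : ℕ}
    (hF : F.IsHomogeneous d) (h : complexifyPoint '' rankBoundary (m + 2) ⊆ projZeros F) :
    MvPolynomial.bind₁ (param MvPolynomial.X) F = 0 := by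
  let g : (ParamIdx m → ℝ) → Matrix (Fin 2) (Fin 2) ℝ :=
    fun w => Matrix.of fun i j => w (Sum.inl (i, j))
  let h' : (ParamIdx m → ℝ) → Matrix (Fin (m + 2)) (Fin (m + 2)) ℝ :=
    fun w => Matrix.of fun i j => w (Sum.inr (Sum.inl (i, j)))
  let k : (ParamIdx m → ℝ) → Matrix (Fin (m + 2)) (Fin (m + 2)) ℝ :=
    fun w => Matrix.of fun i j => w (Sum.inr (Sum.inr (Sum.inl (i, j))))
  let L : (ParamIdx m → ℝ) → TensorIdx (m + 2) → ℝ :=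
    fun w => tangentPart fun x => w (Sum.inr (Sum.inr (Sum.inr x)))
  have hg : Continuous g := continuous_matrix fun i j => continuous_apply _
  have hh : Continuous h' := continuous_matrix fun i j => continuous_apply _
  have hk : Continuous k := continuous_matrix fun i j => continuous_apply _
  have hL : Continuous L := by
    refine continuous_pi fun x => ?_
    simp only [L, tangentPart]
    split_ifs
    · exact continuous_const
    · exact continuous_apply _
  -- Every real parameter in this open set is sent to the boundary by `IsNormal.mem_boundary`;
  -- `modelTensor` with identity matrices shows that the set is nonempty.
  let U : Set (ParamIdx m → ℝ) := {w | (g w).det ≠ 0} ∩ ({w | (h' w).det ≠ 0} ∩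
    ({w | (k w).det ≠ 0} ∩ {w | AlternatingSigns (L w)}))
  have hU : IsOpen U :=
    (isOpen_ne_fun hg.matrix_det continuous_const).inter
      ((isOpen_ne_fun hh.matrix_det continuous_const).inter
        ((isOpen_ne_fun hk.matrix_det continuous_const).inter
          (isOpen_alternatingSigns.preimage hL)))
  have hne : U.Nonempty := by
    let w : ParamIdx m → ℝ := Sum.elim (fun x => (1 : Matrix (Fin 2) (Fin 2) ℝ) x.1 x.2)
      (Sum.elim (fun x => (1 : Matrix (Fin (m + 2)) (Fin (m + 2)) ℝ) x.1 x.2)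
        (Sum.elim (fun x => (1 : Matrix (Fin (m + 2)) (Fin (m + 2)) ℝ) x.1 x.2) (modelTensor m)))
    have h1 : g w = 1 := rfl
    have h2 : h' w = 1 := rfl
    have h3 : k w = 1 := rfl
    have h4 : L w = modelTensor m := (isNormal_modelTensor m).tangentPart_eq
    refine ⟨w, ?_, ?_, ?_, ?_⟩
    · change (g w).det ≠ 0
      rw [h1, det_one]
      exact one_ne_zero
    · change (h' w).det ≠ 0
      rw [h2, det_one]
      exact one_ne_zero
    · change (k w).det ≠ 0
      rw [h3, det_one]
      exact one_ne_zero
    · change AlternatingSigns (L w)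
      rw [h4]
      exact alternatingSigns_modelTensor m
  refine eq_zero_of_eval_eq_zero_of_isOpen Complex.ofRealHom hU hne fun w hw => ?_
  obtain ⟨hw1, hw2, hw3, hw4⟩ := hw
  obtain ⟨hne, hmem⟩ := (isNormal_tangentPart fun x => w (Sum.inr (Sum.inr (Sum.inr x))))
    |>.mem_boundary
    hw4 hw1 hw2 hw3
  obtain ⟨hne', heq⟩ := complexifyPoint_mk hne
  have h1 := h ⟨_, hmem, heq⟩
  rw [mk_mem_projZeros_iff hF] at h1
  rw [eval_bind₁_param, ← map_param]
  exact h1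

theorem isTangent_of_mem_rankBoundary {n : ℕ} (hn : 0 < n) {f : ℙ ℝ (TensorIdx n → ℝ)}
    (hf : f ∈ rankBoundary n) : IsTangent (complexifyVec _ f.rep) := by
  by_contra ht
  exact hf.2 (mem_interior_of_mem_closure hn hf.1 ht)

theorem complexifyPoint_rankBoundary_subset {n : ℕ} (hn : 2 ≤ n) :
    complexifyPoint '' rankBoundary n ⊆ projZeros (hyperdet n) := by
  rintro _ ⟨f, hf, rfl⟩
  obtain ⟨hne, heq⟩ := complexifyPoint_mk f.rep_nonzero
  rw [f.mk_rep] at heq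
  rw [heq, mk_mem_projZeros_iff hyperdet_isHomogeneous, eval_hyperdet_eq_zero_iff hn]
  exact isTangent_of_mem_rankBoundary (by omega) hf

theorem segreDual_subset_projZeros {F : MvPolynomial (TensorIdx (m + 2)) ℂ}
    (hF : MvPolynomial.bind₁ (param MvPolynomial.X) F = 0) :
    segreDual (m + 2) ⊆ projZeros F := by
  intro p hp
  rw [mem_segreDual_iff (by omega)] at hp
  obtain ⟨w, hw⟩ := exists_param_eq hp
  change MvPolynomial.eval p.rep F = 0
  rw [← hw, ← eval_bind₁_param, hF, map_zero]

theorem realRankBoundary_segre {n : ℕ} (hn : 2 ≤ n) :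
    realRankBoundary (segre ℝ n) (segre ℂ n) = segreDual n := by
  obtain ⟨m, rfl⟩ : ∃ m, n = m + 2 := ⟨n - 2, by omega⟩
  have h : realRankBoundary (segre ℝ (m + 2)) (segre ℂ (m + 2)) =
      zariskiClosure (complexifyPoint '' rankBoundary (m + 2)) := by
    simp only [realRankBoundary, genericRankLocus_segre hn, rankBoundary]
  rw [h]
  refine Set.Subset.antisymm (fun p hp => ?_) fun p hp F d hF hsub => ?_
  · rw [segreDual_eq_projZeros hn]
    exact hp _ _ hyperdet_isHomogeneous (complexifyPoint_rankBoundary_subset hn)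
  · exact segreDual_subset_projZeros (bind₁_param_eq_zero hF hsub) hp

/-- The pullback of `hyperdet` along the parametrization is zero, so some irreducible factor pulls
back to zero and vanishes on the dual variety. As a divisor of `hyperdet`, it vanishes nowhere else.
-/
theorem exists_isHyperdeterminant {n : ℕ} (hn : 2 ≤ n) : ∃ F, IsHyperdeterminant n F := by
  obtain ⟨m, rfl⟩ : ∃ m, n = m + 2 := ⟨n - 2, by omega⟩
  have hzero := bind₁_param_eq_zero hyperdet_isHomogeneous (complexifyPoint_rankBoundary_subset hn)
  obtain ⟨s, hs, u, hu⟩ := WfDvdMonoid.exists_factors _ (hyperdet_ne_zero hn)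
  have hprod : MvPolynomial.bind₁ (param MvPolynomial.X) s.prod = 0 := by
    rw [← hu, map_mul] at hzero
    exact (mul_eq_zero.1 hzero).resolve_right
      ((u.isUnit.map (MvPolynomial.bind₁ (param MvPolynomial.X))).ne_zero)
  rw [map_multiset_prod, Multiset.prod_eq_zero_iff, Multiset.mem_map] at hprod
  obtain ⟨F, hFs, hF⟩ := hprod
  have hdvd : F ∣ hyperdet (m + 2) := by
    rw [← hu]
    exact (Multiset.dvd_prod hFs).mul_right _
  refine ⟨F, hs F hFs, exists_isHomogeneous_of_dvd (hyperdet_ne_zero hn) hyperdet_isHomogeneous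
    hdvd, Set.Subset.antisymm (fun p hp => ?_) (segreDual_subset_projZeros hF)⟩
  rw [segreDual_eq_projZeros hn]
  obtain ⟨G, hG⟩ := hdvd
  change MvPolynomial.eval p.rep _ = 0
  rw [hG, map_mul, show MvPolynomial.eval p.rep F = 0 from hp, zero_mul]

end Parametrization

/-! ## Typical ranks -/

section TypicalRanks

theorem isTypicalRank_of_open {ι : Type*} {X : Set (ℙ ℝ (ι → ℝ))} {s : ℕ} {P : (ι → ℝ) → Prop}
    (hP : ScaleInvariant P) (hopen : IsOpen {v | P v})
    (h : ∀ v (hv : v ≠ 0), P v → xRank X (Projectivization.mk ℝ v hv) = s)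
    {v : ι → ℝ} (hv : v ≠ 0) (hPv : P v) : IsTypicalRank X s :=
  ⟨Projectivization.mk ℝ v hv, mem_interior_of_open hP hopen h ((hP.rep_iff hv).2 hPv)⟩

theorem ne_zero_of_det_slice_ne_zero {K : Type*} [Field K] {n : ℕ} (hn : 0 < n)
    {T : TensorIdx n → K} {a : Fin 2 → K} (h : (slice T a).det ≠ 0) : T ≠ 0 := by
  rintro rfl
  have : Nonempty (Fin n) := ⟨⟨0, hn⟩⟩
  rw [slice_zero, det_zero] at h
  exact h rfl

theorem isTypicalRank_segre_self (m : ℕ) : IsTypicalRank (segre ℝ (m + 2)) (m + 2) := by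
  obtain ⟨ε, hε⟩ := ((isNormal_modelTensor m).eventually_signChanges
    (alternatingSigns_modelTensor m)).exists
  have hrank : ∀ (T : TensorIdx (m + 2) → ℝ), SignChanges ![0, 1] ![1, 0]
      (fun k : Fin (m + 2 + 1) => ((k : ℕ) : ℝ) - 1) T →
      HasDecomp (m + 2) T ∧ ∃ a, (slice T a).det ≠ 0 :=
    fun T hT => hT.hasDecomp (by omega) (by simp) (strictMono_natCast_sub_one _)
  obtain ⟨-, a, ha⟩ := hrank _ hε
  refine isTypicalRank_of_open (scaleInvariant_signChanges _ _ _) (isOpen_signChanges _ _ _) ?_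
    (ne_zero_of_det_slice_ne_zero (by omega) ha) hε
  intro v hv h
  obtain ⟨hd, a, ha⟩ := hrank v h
  exact xRank_eq hv hd ha

theorem xRank_eq_succ {K : Type*} [Field K] {n s : ℕ} {T : TensorIdx n → K} (hT : T ≠ 0)
    (h : HasDecomp (s + 1) T) (h' : ¬ HasDecomp s T) :
    xRank (segre K n) (Projectivization.mk K T hT) = (s + 1 : ℕ) := by
  refine le_antisymm ((xRank_le_iff hT).2 h) ?_
  rw [← xRank_le_iff hT, not_le] at h'
  rw [Nat.cast_add, Nat.cast_one]
  exact Order.add_one_le_of_lt h'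

theorem isTypicalRank_segre_succ (m : ℕ) : IsTypicalRank (segre ℝ (m + 2)) (m + 3) := by
  let P : (TensorIdx (m + 2) → ℝ) → Prop := fun T =>
    NegTrace T ∧ (slice T ![1, 0]).det ≠ 0 ∧ (adjMatrix T).det ≠ 0
  have hP : ScaleInvariant P := by
    intro c T hc
    refine and_congr (scaleInvariant_negTrace (by omega) c T hc) (and_congr ?_ ?_)
    · rw [slice_smul, det_smul]
      exact mul_ne_zero_iff_left (pow_ne_zero _ hc)
    · have h1 : adjMatrix (c • T) = c ^ (m + 1) • adjMatrix T := by
        ext k i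
        simp only [adjMatrix, of_apply, Matrix.smul_apply]
        rw [slice_smul, adjugate_smul, Fintype.card_fin]
        rfl
      rw [h1, det_smul]
      exact mul_ne_zero_iff_left (pow_ne_zero _ (pow_ne_zero _ hc))
  have hcont : Continuous fun T : TensorIdx (m + 2) → ℝ => adjMatrix T :=
    continuous_matrix fun k i => (continuous_slice _).matrix_adjugate.matrix_elem k 0
  have hopen : IsOpen {T | P T} :=
    isOpen_negTrace.inter ((isOpen_ne_fun (continuous_slice _).matrix_det continuous_const).inter
      (isOpen_ne_fun hcont.matrix_det continuous_const))
  obtain ⟨T, hT, hT'⟩ := exists_det_slice_and_adjMatrix_ne_zero isOpen_negTrace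
    (exists_negTrace (n := m + 2) (by omega))
  refine isTypicalRank_of_open hP hopen ?_
    (ne_zero_of_det_slice_ne_zero (by omega) hT'.1) ⟨hT, hT'⟩
  rintro v hv ⟨h1, h2, h3⟩
  refine xRank_eq_succ hv (hasDecomp_succ_of_adjMatrix h3) fun hd => ?_
  exact absurd h1 (not_lt.2 (trace_sq_nonneg_of_hasDecomp hd h2))

/-- Every nonempty open set contains a tensor with an invertible slice and invertible `adjMatrix`,
whose rank lies between `n` and `n + 1`. -/
theorem eq_or_eq_of_isTypicalRank {m s : ℕ} (h : IsTypicalRank (segre ℝ (m + 2)) s) :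
    s = m + 2 ∨ s = m + 2 + 1 := by
  obtain ⟨f, hf⟩ := h
  have hne : {v : TensorIdx (m + 2) → ℝ | ∃ h : v ≠ 0, Projectivization.mk ℝ v h ∈
      interior {f | xRank (segre ℝ (m + 2)) f = s}}.Nonempty :=
    ⟨f.rep, f.rep_nonzero, by rwa [f.mk_rep]⟩
  obtain ⟨T, ⟨hT0, hT⟩, h1, h2⟩ := exists_det_slice_and_adjMatrix_ne_zero
    (isOpen_setOf_mk_mem isOpen_interior) hne
  have hs : xRank (segre ℝ (m + 2)) (Projectivization.mk ℝ T hT0) = s := by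
    have hmem := interior_subset hT
    exact hmem
  have h3 := le_of_hasDecomp (hasDecomp_of_xRank_eq hT0 hs) h1
  have h4 := (xRank_le_iff hT0).2 (hasDecomp_succ_of_adjMatrix h2)
  rw [hs] at h4
  have h5 : s ≤ m + 1 + 1 + 1 := by exact_mod_cast h4
  omega

end TypicalRanks

end TensorPencil

theorem mainTheorem8 (n : ℕ) (hn : 2 ≤ n) :
    IsGenericRank (segre ℂ n) n ∧
    (∀ s : ℕ, IsTypicalRank (segre ℝ n) s ↔ s = n ∨ s = n + 1) ∧
    realRankBoundary (segre ℝ n) (segre ℂ n) = segreDual n ∧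
    (∃ F, IsHyperdeterminant n F) := by
  refine ⟨TensorPencil.isGenericRank_segre hn, fun s => ?_, TensorPencil.realRankBoundary_segre hn,
    TensorPencil.exists_isHyperdeterminant hn⟩
  obtain ⟨m, rfl⟩ : ∃ m, n = m + 2 := ⟨n - 2, by omega⟩
  refine ⟨TensorPencil.eq_or_eq_of_isTypicalRank, ?_⟩
  rintro (rfl | rfl)
  · exact TensorPencil.isTypicalRank_segre_self m
  · exact TensorPencil.isTypicalRank_segre_succ m
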